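/- **Setting.** Players $i\in\mathcal N=\{1,\dots,N\}$ have compact convex strategy sets $X_i\subset\mathbb R^{n_i}$ and costs $f_i(x)=\mathbb E[\psi_i(x;\xi)]$, where $X=\prod_i X_i$. For every $x\in X$: $f_i$ is finite, convex and $C^2$ in $x_i$ on an open set containing $X_i$, and the mixed derivatives $\nabla^2_{x_ix_j}f_i(x)$ ($j\ne i$) exist; $\psi_i(\cdot,x_{-i};\xi(\omega))$ is differentiable on an open set containing $X_i$ for every $\omega$; $\nabla_{x_i}f_i(x)=\mathbb E[\nabla_{x_i}\psi_i(x;\xi)]$; and $\mathbb E\|\nabla_{x_i}\psi_i(x;\xi)\|^2\le M_i^2$ with $M_i>0$ independent of $x$. The map $(x,s)\mapsto\nabla_{x_i}\psi_i(x;s)$ is measurable on $X\times\mathbb R^d$. Put $\zeta_{i,\min}=\inf_{x\in X}\lambda_{\min}(\nabla^2_{x_i}f_i(x))$ and $\zeta_{ij,\max}=\sup_{x\in X}\|\nabla^2_{x_ix_j}f_i(x)\|$, and assume that the latter are finite and that $\zeta_{i,\min}>\sum_{j\neq i}\zeta_{ij,\max}$ for all $i$. Fix $\mu>0$; let $\Gamma$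 be the matrix with entries $\Gamma_{ii}=\frac{\mu}{\mu+\zeta_{i,\min}}$ and $\Gamma_{ij}=\frac{\zeta_{ij,\max}}{\mu+\zeta_{i,\min}}$ for $j\ne i$, let $a_\infty=\|\Gamma\|_\infty$ (maximal row sum), $Q_i=\frac{2M_i^2}{\mu^2}+2\,\mathrm{diam}(X_i)^2$, and $\widehat x_i(y)=\arg\min_{u\in X_i}\{f_i(u,y_{-i})+\frac\mu2\|u-y_i\|^2\}$. Let $x^*$ be the Nash equilibrium. A random profile $x$ is an $\epsilon$-NE$_\infty$ if $\max_i\mathbb E\|x_i-x_i^*\|\le\epsilon$. **Scheme.** Start from a random $x_0\in X$. At epoch $k=0,1,2,\dots$ the players in a deterministic set $I_k$ update; every player belongs to at least one of any $B_1\ge1$ consecutive sets $I_k$. Player $i\in I_k$ sees $y_k^i=(x_{j,k-\tau_{ij}(k)})_{j}$ with random integer delays $0\le\tau_{ij}(k)\le k$, $\tau_{ii}(k)=0$, $\tau_{ij}(k)\le B_2$ a.s. With $z_{i,1}=x_{i,k}$ the player performs $j_{i,k}$ projected stochastic gradient steps $$z_{i,t+1}=\Pi_{X_i}\Big[z_{i,t}-\tfrac1{\mu(t+1)}\big(\nabla_{x_i}\psi_i(z_{i,t},y^i_{-i,k};\xi^t_{i,k})+\mu(z_{i,t}-x_{i,k})\big)\Big],\qquad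 t=1,\dots,j_{i,k},$$ and sets $x_{i,k+1}=z_{i,j_{i,k}+1}$; if $i\notin I_k$, then $x_{i,k+1}=x_{i,k}$. Let $\mathcal F_k$ be generated by $x_0$, the samples of the epochs before $k$ and the delays of the epochs up to $k$, and let $\mathcal T$ be generated by all delays. Assume that $x_0$ is independent of $\mathcal T$ and that, conditionally on $\mathcal F_k\vee\sigma(\xi_{i,k}^1,\dots,\xi_{i,k}^{t-1})\vee\mathcal T$, the sampled gradient $\nabla_{x_i}\psi_i(z_{i,t},y_{-i,k}^i;\xi_{i,k}^t)$ is square integrable with mean $\nabla_{x_i}f_i(z_{i,t},y_{-i,k}^i)$ and second moment $\mathbb E\|\nabla_{x_i}\psi_i(x;\xi)\|^2\big|_{x=(z_{i,t},y^i_{-i,k})}$ (for instance: the samples are fresh independent copies of $\xi$, and the delays are deterministic or independent of $x_0$ and of the samples). Let $\beta_{i,k}$ be the number of updates of player $i$ up to and including epoch $k$, let $\alpha_{i,k}=\eta^{\beta_{i,k}}$ with $\eta\in(0,1)$, and let the deterministic integers $j_{i,k}$ ($i\in I_k$) satisfy $Q_i\alpha_{i,k}^{-2}\le j_{i,k}+1$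 and $j_{i,k}\le\lceil Q_i\eta^{-2(k+1)}\rceil$. **Theorem.** Let $C\ge0$ with $\mathbb E\|x_{i,0}-x_i^*\|^2\le C^2$ for all $i$, let $\rho=(\max\{a_\infty,\eta\})^{1/(n_0+1)}$ with $n_0=\lceil B_2/B_1\rceil$, $c=\rho^{1/B_1}$, $q\in(c,1)$, $D\ge1/\ln((q/c)^e)$, $\epsilon>0$ and $\hat\epsilon=\frac{\epsilon}{C+D}\rho^{(B_1-1)/B_1}$. Then: 1. $\mathbb E[\|x_{i,k+1}-\widehat x_i(y_k^i)\|^2\mid\mathcal F_k]\le\alpha_{i,k}^2$ a.s. for all $k$ and $i\in I_k$. 2. There is a $K$ such that $x_k$ is an $\epsilon$-NE$_\infty$ for every $k\ge K$ and, for every player $i$, the number $\sum_{k<K,\,i\in I_k}j_{i,k}$ of projected gradient steps used to compute $x_K$ is at most $$\ell_i^{(1)}(\eta)=\frac{Q_i}{\eta^4\ln(1/\eta^2)}\Big(\frac1{\hat\epsilon}\Big)^{\frac{\ln(1/\eta^2)}{\ln(1/q)}}+\max\Big\{0,\Big\lceil\frac{\ln(1/\hat\epsilon)}{\ln(1/q)}\Big\rceil\Big\}.$$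 3. If $B_1=1$ and $B_2=0$, then $c=\max\{a_\infty,\eta\}$ and $$\ell_i^{(1)}(\eta)=\frac{Q_i}{\eta^4\ln(1/\eta^2)}\Big(\frac{C+D}{\epsilon}\Big)^{\frac{\ln(1/\eta^2)}{\ln(1/q)}}+\max\Big\{0,\Big\lceil\frac{\ln((C+D)/\epsilon)}{\ln(1/q)}\Big\rceil\Big\}.$$ -/

import Mathlib

open MeasureTheory ProbabilityTheory

namespace AsyncBR

/-- The decision space `ℝ^m` with its Euclidean norm. -/
abbrev Vec (m : ℕ) : Type := EuclideanSpace ℝ (Fin m)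

/-- Strategy profiles of the `N` players; player `j` has a strategy in `ℝ^(n j)`. -/
abbrev Profile {N : ℕ} (n : Fin N → ℕ) : Type := ∀ j : Fin N, Vec (n j)

/-- The partial gradient `∇_{x_i} g (x)`. -/
noncomputable def partialGrad {N : ℕ} {n : Fin N → ℕ} (i : Fin N) (g : Profile n → ℝ)
    (x : Profile n) : Vec (n i) :=
  gradient (fun u => g (Function.update x i u)) (x i)

/-- The second-order block `∇²_{x_i x_j} g (x)`: the derivative in `x_j` of `∇_{x_i} g`
(for `j = i` it is the Hessian in `x_i`). -/
noncomputable def hessBlock {N : ℕ} {n : Fin N → ℕ} (i j : Fin N) (g : Profile n → ℝ)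
    (x : Profile n) : Vec (n j) →L[ℝ] Vec (n i) :=
  fderiv ℝ (fun v => partialGrad i g (Function.update x j v)) (x j)

/-- The smallest eigenvalue of the symmetric part `(T + Tᵀ) / 2`. -/
noncomputable def lambdaMin {m : ℕ} (T : Vec m →L[ℝ] Vec m) : ℝ :=
  sInf {r : ℝ | Module.End.HasEigenvalue
    (((2 : ℝ)⁻¹ • (T + ContinuousLinearMap.adjoint T) : Vec m →L[ℝ] Vec m) :
      Vec m →ₗ[ℝ] Vec m) r}

/-- `v` is the Euclidean projection of `u` on the set `K`. -/
def IsProj {m : ℕ} (K : Set (Vec m)) (u v : Vec m) : Prop :=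
  v ∈ K ∧ ∀ w ∈ K, ‖u - v‖ ≤ ‖u - w‖

/-- The data of an `N`-player stochastic Nash game: strategy sets `X_i`, sampled costs
`ψ_i (x; ξ)` and the random vector `ξ`. -/
structure Game {N : ℕ} (n : Fin N → ℕ) (d : ℕ) (Ω : Type*) where
  X : ∀ i : Fin N, Set (Vec (n i))
  ψ : Fin N → Profile n → Vec d → ℝ
  ξ : Ω → Vec d

namespace Game

variable {N : ℕ} {n : Fin N → ℕ} {d : ℕ} {Ω : Type*} [MeasurableSpace Ω]

/-- `X = ∏ X_i`. -/
def feasible (G : Game n d Ω) : Set (Profile n) := {x | ∀ i, x i ∈ G.X i}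

/-- The expected cost `f_i (x) = 𝔼[ψ_i (x; ξ)]`. -/
noncomputable def cost (G : Game n d Ω) (P : Measure Ω) (i : Fin N) (x : Profile n) : ℝ :=
  ∫ ω, G.ψ i x (G.ξ ω) ∂P

/-- The sampled gradient `∇_{x_i} ψ_i (x; s)`. -/
noncomputable def sampleGrad (G : Game n d Ω) (i : Fin N) (x : Profile n) (s : Vec d) :
    Vec (n i) :=
  partialGrad i (fun y => G.ψ i y s) x

/-- `x` is a Nash equilibrium. -/
def IsNash (G : Game n d Ω) (P : Measure Ω) (x : Profile n) : Prop :=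
  x ∈ G.feasible ∧
    ∀ i, ∀ u ∈ G.X i, G.cost P i x ≤ G.cost P i (Function.update x i u)

/-- The standing assumptions on the game, with second-moment bounds `M_i`. -/
structure Assumptions (G : Game n d Ω) (P : Measure Ω) (M : Fin N → ℝ) : Prop where
  compact_X : ∀ i, IsCompact (G.X i)
  convex_X : ∀ i, Convex ℝ (G.X i)
  measurable_ξ : Measurable G.ξ
  measurable_sampleGrad : ∀ i, Measurable
    (fun p : {x : Profile n // x ∈ G.feasible} × Vec d => G.sampleGrad i p.1 p.2)
  /-- `f_i` is finite, convex and twice continuously differentiable in `x_i` on an open set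
  containing `X_i`. -/
  smooth_cost : ∀ i, ∀ x ∈ G.feasible, ∃ U : Set (Vec (n i)), IsOpen U ∧ G.X i ⊆ U ∧
    (∀ u ∈ U, Integrable (fun ω => G.ψ i (Function.update x i u) (G.ξ ω)) P) ∧
    ConvexOn ℝ U (fun u => G.cost P i (Function.update x i u)) ∧
    ContDiffOn ℝ 2 (fun u => G.cost P i (Function.update x i u)) U
  /-- The mixed second derivatives `∇²_{x_i x_j} f_i` exist on `X`. -/
  mixed_cost : ∀ i j, j ≠ i → ∀ x ∈ G.feasible,
    DifferentiableAt ℝ (fun v => partialGrad i (G.cost P i) (Function.update x j v)) (x j)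
  smooth_sample : ∀ i, ∀ x ∈ G.feasible, ∀ ω, ∃ U : Set (Vec (n i)), IsOpen U ∧ G.X i ⊆ U ∧
    DifferentiableOn ℝ (fun u => G.ψ i (Function.update x i u) (G.ξ ω)) U
  grad_cost : ∀ i, ∀ x ∈ G.feasible,
    partialGrad i (G.cost P i) x = ∫ ω, G.sampleGrad i x (G.ξ ω) ∂P
  M_pos : ∀ i, 0 < M i
  second_moment : ∀ i, ∀ x ∈ G.feasible,
    Integrable (fun ω => ‖G.sampleGrad i x (G.ξ ω)‖ ^ 2) P ∧
      ∫ ω, ‖G.sampleGrad i x (G.ξ ω)‖ ^ 2 ∂P ≤ M i ^ 2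

/-- `ζ_{i,min} = inf_{x ∈ X} λ_min (∇²_{x_i} f_i (x))`. -/
noncomputable def zetaMin (G : Game n d Ω) (P : Measure Ω) (i : Fin N) : ℝ :=
  ⨅ x : {x : Profile n // x ∈ G.feasible}, lambdaMin (hessBlock i i (G.cost P i) x)

/-- `ζ_{ij,max} = sup_{x ∈ X} ‖∇²_{x_i x_j} f_i (x)‖` (operator norm). -/
noncomputable def zetaMax (G : Game n d Ω) (P : Measure Ω) (i j : Fin N) : ℝ :=
  ⨆ x : {x : Profile n // x ∈ G.feasible}, ‖hessBlock i j (G.cost P i) x‖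

/-- Strict diagonal dominance: the suprema `ζ_{ij,max}` are finite and
`ζ_{i,min} > ∑_{j ≠ i} ζ_{ij,max}`. -/
def DiagDominant (G : Game n d Ω) (P : Measure Ω) : Prop :=
  ∀ i, (∀ j, j ≠ i → BddAbove (Set.range
      (fun x : {x : Profile n // x ∈ G.feasible} => ‖hessBlock i j (G.cost P i) x‖))) ∧
    ∑ j ∈ Finset.univ.erase i, G.zetaMax P i j < G.zetaMin P i

/-- The matrix `Γ`. -/
noncomputable def gammaMatrix (G : Game n d Ω) (P : Measure Ω) (μ : ℝ) :
    Matrix (Fin N) (Fin N) ℝ :=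
  fun i j => if j = i then μ / (μ + G.zetaMin P i)
    else G.zetaMax P i j / (μ + G.zetaMin P i)

/-- `a_∞ = ‖Γ‖_∞`, the matrix norm induced by the vector `∞`-norm (maximal row sum). -/
noncomputable def aInf (G : Game n d Ω) (P : Measure Ω) (μ : ℝ) : ℝ :=
  letI := Matrix.linftyOpNormedAddCommGroup (m := Fin N) (n := Fin N) (α := ℝ)
  ‖G.gammaMatrix P μ‖

/-- The proximal best response
`x̂_i (y) = argmin_{u ∈ X_i} f_i (u, y_{-i}) + (μ / 2) ‖u - y_i‖²`. -/
noncomputable def proxBR (G : Game n d Ω) (P : Measure Ω) (μ : ℝ) (i : Fin N)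
    (y : Profile n) : Vec (n i) :=
  Classical.epsilon (fun v => v ∈ G.X i ∧
    IsMinOn (fun u => G.cost P i (Function.update y i u) + μ / 2 * ‖u - y i‖ ^ 2) (G.X i) v)

/-- `Q_i = 2 M_i² / μ² + 2 D_{X_i}²`, with `D_{X_i}` the diameter of `X_i`. -/
noncomputable def Q (G : Game n d Ω) (M : Fin N → ℝ) (μ : ℝ) (i : Fin N) : ℝ :=
  2 * M i ^ 2 / μ ^ 2 + 2 * Metric.diam (G.X i) ^ 2

end Game

/-- A random profile is an `ε`-NE_∞ relative to the equilibrium `xs`: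
`max_i 𝔼‖x_i - xs_i‖ ≤ ε`. -/
def IsEpsNEInf {N : ℕ} {n : Fin N → ℕ} {Ω : Type*} [MeasurableSpace Ω] (P : Measure Ω)
    (xs : Profile n) (ε : ℝ) (x : Ω → Profile n) : Prop :=
  ∀ i, Integrable (fun ω => ‖x ω i - xs i‖) P ∧ ∫ ω, ‖x ω i - xs i‖ ∂P ≤ ε

/-- The data of one execution of the asynchronous scheme with stochastic-approximation inner
loops: `I k` is the set of players updating at epoch `k`, `τ i j k` the delay `τ_{ij}(k)`,
`steps i k` the number of projected gradient steps taken by player `i ∈ I k` at epoch `k`,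
`sample i k t` the sample `ξ_{i,k}^t`, `z i k t` the inner iterate `z_{i,t}` of epoch `k`,
and `x k` the profile `x_k`. -/
structure Run {N : ℕ} (n : Fin N → ℕ) (d : ℕ) (Ω : Type*) where
  I : ℕ → Finset (Fin N)
  τ : Fin N → Fin N → ℕ → Ω → ℕ
  steps : Fin N → ℕ → ℕ
  sample : Fin N → ℕ → ℕ → Ω → Vec d
  z : ∀ i : Fin N, ℕ → ℕ → Ω → Vec (n i)
  x : ℕ → Ω → Profile n

namespace Run

variable {N : ℕ} {n : Fin N → ℕ} {d : ℕ} {Ω : Type*} [MeasurableSpace Ω]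

/-- The outdated profile `y_k^i = (x_{1,k-τ_{i1}(k)}, …, x_{N,k-τ_{iN}(k)})`. -/
def y (R : Run n d Ω) (i : Fin N) (k : ℕ) (ω : Ω) : Profile n :=
  fun j => R.x (k - R.τ i j k ω) ω j

/-- `β_{i,k}`: the number of updates of player `i` up to and including epoch `k`. -/
def updates (R : Run n d Ω) (i : Fin N) (k : ℕ) : ℕ :=
  ((Finset.range (k + 1)).filter (fun l => i ∈ R.I l)).card

/-- The number of projected gradient steps of player `i` during the epochs `0, …, K - 1`,
that is, to compute `x_K`. -/
def totalSteps (R : Run n d Ω) (i : Fin N) (K : ℕ) : ℕ :=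
  ∑ k ∈ (Finset.range K).filter (fun k => i ∈ R.I k), R.steps i k

/-- The `σ`-field generated by the delays of the epochs in `S`. -/
@[reducible] def delayInfo (R : Run n d Ω) (S : Set ℕ) : MeasurableSpace Ω :=
  ⨆ l ∈ S, ⨆ i ∈ R.I l, ⨆ j, MeasurableSpace.comap (R.τ i j l) ⊤

/-- `𝓕_k`: generated by `x_0`, the samples of the epochs `l < k` and the delays of the epochs
`l ≤ k`. -/
@[reducible] def info (R : Run n d Ω) (k : ℕ) : MeasurableSpace Ω :=
  MeasurableSpace.comap (R.x 0) inferInstance ⊔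
    (⨆ l ∈ Set.Iio k, ⨆ i ∈ R.I l, ⨆ t ∈ Set.Icc 1 (R.steps i l),
      MeasurableSpace.comap (R.sample i l t) inferInstance) ⊔
    R.delayInfo (Set.Iic k)

/-- The conditioning `σ`-field of the oracle call `t` of player `i` at epoch `k`:
`𝓕_k`, the samples `ξ_{i,k}^1, …, ξ_{i,k}^{t-1}`, and the whole delay process. -/
@[reducible] def oracleInfo (R : Run n d Ω) (i : Fin N) (k t : ℕ) : MeasurableSpace Ω :=
  R.info k ⊔
    (⨆ r ∈ Set.Ico 1 t, MeasurableSpace.comap (R.sample i k r) inferInstance) ⊔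
    R.delayInfo Set.univ

/-- The asynchronous protocol: every player updates at least once in any `B₁` consecutive
epochs, and the delays are random integers bounded by `B₂` almost surely. -/
structure Protocol (R : Run n d Ω) (P : Measure Ω) (B₁ B₂ : ℕ) : Prop where
  B₁_pos : 0 < B₁
  update_often : ∀ i k, ∃ l, k ≤ l ∧ l < k + B₁ ∧ i ∈ R.I l
  measurable_τ : ∀ i j k, Measurable (R.τ i j k)
  delay_le_time : ∀ k, ∀ i ∈ R.I k, ∀ j ω, R.τ i j k ω ≤ k
  delay_self : ∀ k, ∀ i ∈ R.I k, ∀ ω, R.τ i i k ω = 0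
  delay_le : ∀ k, ∀ i ∈ R.I k, ∀ j, ∀ᵐ ω ∂P, R.τ i j k ω ≤ B₂

/-- `R` is an execution of the asynchronous proximal best-response scheme for the game `G` in
which the updates are computed by projected stochastic gradient steps with step sizes
`γ_t = 1 / (μ (t + 1))`, `t = 1, 2, …`. -/
structure IsExecution (R : Run n d Ω) (G : Game n d Ω) (P : Measure Ω) (μ : ℝ) : Prop where
  measurable_init : Measurable (R.x 0)
  init_mem : ∀ ω, R.x 0 ω ∈ G.feasible
  measurable_sample : ∀ i k t, Measurable (R.sample i k t)
  inner_init : ∀ k, ∀ i ∈ R.I k, ∀ ω, R.z i k 1 ω = R.x k ω i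
  inner_step : ∀ k, ∀ i ∈ R.I k, ∀ t, 1 ≤ t → t ≤ R.steps i k → ∀ ω,
    IsProj (G.X i)
      (R.z i k t ω - (1 / (μ * (t + 1))) •
        (G.sampleGrad i (Function.update (R.y i k ω) i (R.z i k t ω)) (R.sample i k t ω)
          + μ • (R.z i k t ω - R.x k ω i)))
      (R.z i k (t + 1) ω)
  update : ∀ k, ∀ i ∈ R.I k, ∀ ω, R.x (k + 1) ω i = R.z i k (R.steps i k + 1) ω
  no_update : ∀ k, ∀ i, i ∉ R.I k → ∀ ω, R.x (k + 1) ω i = R.x k ω i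

/-- The stochastic oracle: conditionally on the past (and on the delays), the sampled gradient
at the query point has the mean `∇_{x_i} f_i` and the second moment `𝔼‖∇_{x_i} ψ_i (·; ξ)‖²`
of that point; the initial profile is independent of the delays. -/
structure Oracle (R : Run n d Ω) (G : Game n d Ω) (P : Measure Ω) : Prop where
  init_indep : Indep (MeasurableSpace.comap (R.x 0) inferInstance) (R.delayInfo Set.univ) P
  integrable_sq : ∀ k, ∀ i ∈ R.I k, ∀ t, 1 ≤ t → t ≤ R.steps i k →
    Integrable (fun ω => ‖G.sampleGrad i (Function.update (R.y i k ω) i (R.z i k t ω))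
      (R.sample i k t ω)‖ ^ 2) P
  unbiased : ∀ k, ∀ i ∈ R.I k, ∀ t, 1 ≤ t → t ≤ R.steps i k →
    P[fun ω => G.sampleGrad i (Function.update (R.y i k ω) i (R.z i k t ω))
        (R.sample i k t ω) | R.oracleInfo i k t] =ᵐ[P]
      fun ω => partialGrad i (G.cost P i) (Function.update (R.y i k ω) i (R.z i k t ω))
  second_moment : ∀ k, ∀ i ∈ R.I k, ∀ t, 1 ≤ t → t ≤ R.steps i k →
    P[fun ω => ‖G.sampleGrad i (Function.update (R.y i k ω) i (R.z i k t ω))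
        (R.sample i k t ω)‖ ^ 2 | R.oracleInfo i k t] =ᵐ[P]
      fun ω => ∫ ω', ‖G.sampleGrad i (Function.update (R.y i k ω) i (R.z i k t ω))
        (G.ξ ω')‖ ^ 2 ∂P

end Run

/-- `ρ = (max {a, η})^{1 / (n₀ + 1)}` with `n₀ = ⌈B₂ / B₁⌉`. -/
noncomputable def rho (a η : ℝ) (B₁ B₂ : ℕ) : ℝ :=
  (max a η) ^ (1 / ((⌈(B₂ : ℝ) / (B₁ : ℝ)⌉₊ : ℝ) + 1))

/-- `c = ρ^{1 / B₁}`. -/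
noncomputable def cRate (a η : ℝ) (B₁ B₂ : ℕ) : ℝ :=
  rho a η B₁ B₂ ^ (1 / (B₁ : ℝ))

/-- `ε̂ = ε / (C + D) · ρ^{(B₁ - 1) / B₁}`. -/
noncomputable def epsHat (a η C D ε : ℝ) (B₁ B₂ : ℕ) : ℝ :=
  ε / (C + D) * rho a η B₁ B₂ ^ (((B₁ : ℝ) - 1) / (B₁ : ℝ))

/-- `Q / (η⁴ ln (1/η²)) · (1/e)^{ln (1/η²) / ln (1/q)} + max {0, ⌈ln (1/e) / ln (1/q)⌉}`;
the complexity bound is its value at `e = ε̂`. -/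
noncomputable def ell (Q η q e : ℝ) : ℝ :=
  Q / (η ^ 4 * Real.log (1 / η ^ 2)) *
      (1 / e) ^ (Real.log (1 / η ^ 2) / Real.log (1 / q))
    + (⌈Real.log (1 / e) / Real.log (1 / q)⌉₊ : ℝ)

end AsyncBR

namespace AsyncBR

open scoped RealInnerProductSpace

/-! Two contractions are combined. For the exact proximal best response, the Hessian bound makes
`∇_{x_i} f_i` strongly monotone in the own variable, and the mixed blocks make it Lipschitz in the
rivals' variables. Comparing first-order conditions gives `‖x̂_i(x) - x̂_i(y)‖ ≤ ∑ Γ_ij ‖x_j -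
y_j‖`; diagonal dominance makes every row sum at most `a_∞ < 1`, and the Nash equilibrium is a fixed
point (`norm_minimizer_sub_le`, `aInf_lt_one`, `proxBR_nash`). The inner loop is projected
stochastic gradient descent on a strongly convex objective. Its mean square error obeys `e_{t+1} ≤
(1 - 2/(t+1)) e_t + Q/(t+1)²`, hence `e_t ≤ Q/t` (`setIntegral_step_le`,
`setIntegral_norm_sub_proxBR_sq_le`). Random delays are the obstacle in the outer loop: an
expectation of `‖x_{k-τ} - x*‖` is not controlled by the expectations at fixed indices. Therefore
every estimate is proved on all events `A` of the delay `σ`-field, in the form `∫_A … ≤ b · P(A)`;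
such bounds survive splitting `A` by the value of a delay (`setIntegral_random_index_le`). Induction
on the epoch gives `(C + k) ρ^⌊k/B₁⌋` (`setIntegral_norm_x_sub_le`): an update sees profiles at most
`n₀ + 1` blocks of length `B₁` old, and the factor `a_∞ ≤ ρ^(n₀+1)` pays for that age. Finally `k
c^k ≤ D q^k` turns this into a geometric rate, and summing the inner step counts up to
`⌈ln(1/ε̂)/ln(1/q)⌉` gives the complexity. -/

theorem lambdaMin_mul_norm_sq_le {m : ℕ} (T : Vec m →L[ℝ] Vec m) (v : Vec m) :
    lambdaMin T * ‖v‖ ^ 2 ≤ ⟪T v, v⟫ := by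
  rcases eq_or_ne v 0 with rfl | hv
  · simp
  have : Nontrivial (Vec m) := ⟨⟨v, 0, hv⟩⟩
  set S : Vec m →L[ℝ] Vec m := (2 : ℝ)⁻¹ • (T + ContinuousLinearMap.adjoint T) with hS
  have hself : IsSelfAdjoint S := by
    rw [hS]
    refine IsSelfAdjoint.smul (by simp [IsSelfAdjoint]) ?_
    have h := IsSelfAdjoint.add_star_self T
    rwa [ContinuousLinearMap.star_eq_adjoint] at h
  have hsymm : (S : Vec m →ₗ[ℝ] Vec m).IsSymmetric :=
    ContinuousLinearMap.isSelfAdjoint_iff_isSymmetric.1 hself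
  have hSv : ⟪S v, v⟫ = ⟪T v, v⟫ := by
    rw [hS, smul_apply, add_apply, real_inner_smul_left,
      inner_add_left, ContinuousLinearMap.adjoint_inner_left, real_inner_comm (T v) v]
    ring
  -- The infimum of the Rayleigh quotient of the symmetric part is itself an eigenvalue, so it
  -- dominates the least eigenvalue; `T` and its symmetric part have the same quadratic form.
  have heig := hsymm.hasEigenvalue_iInf_of_finiteDimensional
  have hle : lambdaMin T ≤ _ :=
    csInf_le (Module.End.finite_hasEigenvalue (S : Vec m →ₗ[ℝ] Vec m)).bddBelow heig
  have hbdd : BddBelow (Set.range fun x : {x : Vec m // x ≠ 0} =>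
      RCLike.re (inner ℝ ((S : Vec m →ₗ[ℝ] Vec m) x) (x : Vec m)) / ‖(x : Vec m)‖ ^ 2) := by
    refine ⟨-‖S‖, ?_⟩
    rintro _ ⟨x, rfl⟩
    exact (abs_le.1 (S.rayleighQuotient_le_norm (x : Vec m))).1
  have hle2 := hle.trans (ciInf_le hbdd ⟨v, hv⟩)
  have hpos : 0 < ‖v‖ ^ 2 := by positivity
  rw [← hSv]
  exact (le_div_iff₀ hpos).1 hle2

/-! ### Strong monotonicity, Lipschitz coupling and the proximal best response -/

namespace Game

variable {N : ℕ} {n : Fin N → ℕ} {d : ℕ} {Ω : Type*}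

theorem update_mem_feasible {G : Game n d Ω} {x : Profile n} (hx : x ∈ G.feasible) {j : Fin N}
    {v : Vec (n j)} (hv : v ∈ G.X j) : Function.update x j v ∈ G.feasible := by
  intro l
  rcases eq_or_ne l j with rfl | h
  · simpa using hv
  · simpa [Function.update_of_ne h] using hx l

variable [MeasurableSpace Ω]

theorem zetaMax_nonneg (G : Game n d Ω) (P : Measure Ω) (i j : Fin N) : 0 ≤ G.zetaMax P i j :=
  Real.iSup_nonneg fun _ => norm_nonneg _

theorem DiagDominant.zetaMin_pos {G : Game n d Ω} {P : Measure Ω} (h : G.DiagDominant P)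
    (i : Fin N) : 0 < G.zetaMin P i :=
  (Finset.sum_nonneg fun j _ => G.zetaMax_nonneg P i j).trans_lt (h i).2

theorem DiagDominant.zetaMin_le {G : Game n d Ω} {P : Measure Ω} (h : G.DiagDominant P)
    (i : Fin N) {x : Profile n} (hx : x ∈ G.feasible) :
    G.zetaMin P i ≤ lambdaMin (hessBlock i i (G.cost P i) x) := by
  have hb : BddBelow (Set.range fun x : {x : Profile n // x ∈ G.feasible} =>
      lambdaMin (hessBlock i i (G.cost P i) x)) := by
    -- A real infimum that is unbounded below has the default value `0`, which diagonal dominance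
    -- excludes.
    by_contra hb
    exact (h.zetaMin_pos i).ne' (Real.iInf_of_not_bddBelow hb)
  exact ciInf_le hb ⟨x, hx⟩

theorem DiagDominant.norm_hessBlock_le {G : Game n d Ω} {P : Measure Ω} (h : G.DiagDominant P)
    {i j : Fin N} (hij : j ≠ i) {x : Profile n} (hx : x ∈ G.feasible) :
    ‖hessBlock i j (G.cost P i) x‖ ≤ G.zetaMax P i j :=
  le_ciSup ((h i).1 j hij) ⟨x, hx⟩

theorem partialGrad_update (g : Profile n → ℝ) (i : Fin N) (y : Profile n) (u : Vec (n i)) :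
    partialGrad i g (Function.update y i u) = gradient (fun w => g (Function.update y i w)) u := by
  simp [partialGrad]

section Analysis

variable {G : Game n d Ω} {P : Measure Ω} {M : Fin N → ℝ}

theorem Assumptions.contDiffAt_cost (hG : G.Assumptions P M) {i : Fin N} {y : Profile n}
    (hy : y ∈ G.feasible) {u : Vec (n i)} (hu : u ∈ G.X i) :
    ContDiffAt ℝ 2 (fun w => G.cost P i (Function.update y i w)) u := by
  obtain ⟨U, hU, hXU, -, -, hd⟩ := hG.smooth_cost i y hy
  exact hd.contDiffAt (hU.mem_nhds (hXU hu))

theorem Assumptions.hasGradientAt_cost (hG : G.Assumptions P M) {i : Fin N} {y : Profile n}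
    (hy : y ∈ G.feasible) {u : Vec (n i)} (hu : u ∈ G.X i) :
    HasGradientAt (fun w => G.cost P i (Function.update y i w))
      (partialGrad i (G.cost P i) (Function.update y i u)) u := by
  rw [partialGrad_update]
  exact ((hG.contDiffAt_cost hy hu).differentiableAt (by norm_num)).hasGradientAt

theorem Assumptions.hasFDerivAt_partialGrad (hG : G.Assumptions P M) {i : Fin N} {y : Profile n}
    (hy : y ∈ G.feasible) {u : Vec (n i)} (hu : u ∈ G.X i) :
    HasFDerivAt (fun w => partialGrad i (G.cost P i) (Function.update y i w))
      (hessBlock i i (G.cost P i) (Function.update y i u)) u := by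
  have h1 : DifferentiableAt ℝ (fun w => partialGrad i (G.cost P i) (Function.update y i w)) u := by
    have h2 : (fun w => partialGrad i (G.cost P i) (Function.update y i w)) =
        fun w => (InnerProductSpace.toDual ℝ (Vec (n i))).symm
          (fderiv ℝ (fun w => G.cost P i (Function.update y i w)) w) := by
      funext w
      rw [partialGrad_update]
      rfl
    rw [h2]
    have h3 := ((hG.contDiffAt_cost hy hu).fderiv_right (m := 1) (by norm_num)).differentiableAt
      (by norm_num)
    exact ((InnerProductSpace.toDual ℝ (Vec (n i))).symm.toContinuousLinearEquiv
      |>.differentiableAt).comp u h3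
  have h4 := h1.hasFDerivAt
  simpa [hessBlock] using h4

/-- The mean value theorem along the segment from `v` to `u` turns the gradient difference into a
Hessian at an intermediate feasible point, whose quadratic form is at least `zetaMin`. -/
theorem Assumptions.strongly_monotone (hG : G.Assumptions P M) (hdd : G.DiagDominant P)
    {i : Fin N} {y : Profile n} (hy : y ∈ G.feasible) {u v : Vec (n i)} (hu : u ∈ G.X i)
    (hv : v ∈ G.X i) :
    G.zetaMin P i * ‖u - v‖ ^ 2 ≤
      ⟪partialGrad i (G.cost P i) (Function.update y i u) -
        partialGrad i (G.cost P i) (Function.update y i v), u - v⟫ := by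
  set g := fun w => partialGrad i (G.cost P i) (Function.update y i w) with hg
  have hmem : ∀ t ∈ Set.Icc (0 : ℝ) 1, v + t • (u - v) ∈ G.X i := fun t ht =>
    (hG.convex_X i).add_smul_sub_mem hv hu ht
  have hder : ∀ t ∈ Set.Icc (0 : ℝ) 1, HasDerivAt (fun t : ℝ => ⟪g (v + t • (u - v)), u - v⟫)
      ⟪hessBlock i i (G.cost P i) (Function.update y i (v + t • (u - v))) (u - v), u - v⟫ t := by
    intro t ht
    have h1 : HasDerivAt (fun t : ℝ => v + t • (u - v)) (u - v) t := by
      simpa using ((hasDerivAt_id t).smul_const (u - v)).const_add v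
    have h2 := (hG.hasFDerivAt_partialGrad hy (hmem t ht)).comp_hasDerivAt t h1
    simpa using h2.inner ℝ (hasDerivAt_const t (u - v))
  obtain ⟨t, ht, hs⟩ := exists_hasDerivAt_eq_slope _ _ (zero_lt_one' ℝ)
    (fun t ht => (hder t ht).continuousAt.continuousWithinAt)
    (fun t ht => hder t (Set.Ioo_subset_Icc_self ht))
  have hval : ⟪g u - g v, u - v⟫ =
      ⟪hessBlock i i (G.cost P i) (Function.update y i (v + t • (u - v))) (u - v), u - v⟫ := by
    rw [hs, inner_sub_left]
    simp
  have hfe := update_mem_feasible hy (hmem t (Set.Ioo_subset_Icc_self ht))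
  change _ ≤ ⟪g u - g v, u - v⟫
  rw [hval]
  exact (mul_le_mul_of_nonneg_right (hdd.zetaMin_le i hfe) (by positivity)).trans
    (lambdaMin_mul_norm_sq_le _ _)

theorem Assumptions.norm_partialGrad_update_sub_le (hG : G.Assumptions P M)
    (hdd : G.DiagDominant P) {i j : Fin N} (hij : j ≠ i) {x : Profile n} (hx : x ∈ G.feasible)
    {v : Vec (n j)} (hv : v ∈ G.X j) :
    ‖partialGrad i (G.cost P i) (Function.update x j v) - partialGrad i (G.cost P i) x‖ ≤
      G.zetaMax P i j * ‖v - x j‖ := by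
  have h := (hG.convex_X j).norm_image_sub_le_of_norm_fderiv_le (𝕜 := ℝ)
    (f := fun v => partialGrad i (G.cost P i) (Function.update x j v)) (C := G.zetaMax P i j)
    (x := x j) (y := v) ?_ ?_ (hx j) hv
  · simpa using h
  · intro w hw
    simpa using hG.mixed_cost i j hij _ (update_mem_feasible hx hw)
  · intro w hw
    simpa [hessBlock] using hdd.norm_hessBlock_le hij (update_mem_feasible hx hw)

/-- The rivals' blocks are switched from `y` to `x` one at a time. All intermediate profiles stay
feasible because the feasible set is a product, so each switch costs one mixed-block bound. -/
theorem Assumptions.norm_partialGrad_sub_le (hG : G.Assumptions P M)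
    (hdd : G.DiagDominant P) {i : Fin N} {x y : Profile n} (hx : x ∈ G.feasible)
    (hy : y ∈ G.feasible) (hxy : x i = y i) :
    ‖partialGrad i (G.cost P i) x - partialGrad i (G.cost P i) y‖ ≤
      ∑ j ∈ Finset.univ.erase i, G.zetaMax P i j * ‖x j - y j‖ := by
  have key : ∀ s : Finset (Fin N), i ∉ s →
      ‖partialGrad i (G.cost P i) (s.piecewise x y) - partialGrad i (G.cost P i) y‖ ≤
        ∑ j ∈ s, G.zetaMax P i j * ‖x j - y j‖ := by
    intro s
    induction s using Finset.induction_on with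
    | empty => simp
    | insert j s hj ih =>
      intro hi
      rw [Finset.mem_insert, not_or] at hi
      rw [Finset.piecewise_insert, Finset.sum_insert hj]
      have hfe : s.piecewise x y ∈ G.feasible := by
        intro l
        by_cases hl : l ∈ s <;> simp [hl, hx l, hy l]
      have h1 := hG.norm_partialGrad_update_sub_le hdd (Ne.symm hi.1) hfe (hx j)
      rw [Finset.piecewise_eq_of_notMem _ _ _ hj] at h1
      exact (norm_sub_le_norm_sub_add_norm_sub _ _ _).trans (add_le_add h1 (ih hi.2))
  have h := key (Finset.univ.erase i) (by simp)
  have hpw : (Finset.univ.erase i).piecewise x y = x := by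
    funext l
    by_cases hl : l = i
    · subst hl; simp [hxy]
    · simp [hl]
  rwa [hpw] at h

/-- First-order optimality of `u` for the proximal problem of player `i` at `y`. -/
theorem Assumptions.inner_nonneg_of_isMinOn (hG : G.Assumptions P M) {μ : ℝ} {i : Fin N}
    {y : Profile n} (hy : y ∈ G.feasible) {u w : Vec (n i)} (hu : u ∈ G.X i)
    (hmin : IsMinOn (fun u => G.cost P i (Function.update y i u) + μ / 2 * ‖u - y i‖ ^ 2)
      (G.X i) u) (hw : w ∈ G.X i) :
    0 ≤ ⟪partialGrad i (G.cost P i) (Function.update y i u) + μ • (u - y i), w - u⟫ := by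
  have h1 := (hG.hasGradientAt_cost hy hu).hasFDerivAt
  have h2 : HasFDerivAt (fun u : Vec (n i) => μ / 2 * ‖u - y i‖ ^ 2)
      (μ • innerSL ℝ (u - y i)) u := by
    have h3 := (((hasFDerivAt_id u).sub_const (y i)).norm_sq).const_mul (μ / 2)
    refine h3.congr_fderiv ?_
    ext z
    simp only [smul_apply, innerSL_apply_apply, ContinuousLinearMap.comp_apply,
      ContinuousLinearMap.id_apply, id, smul_eq_mul, nsmul_eq_mul]
    push_cast
    ring
  have h4 := hmin.localize.hasFDerivWithinAt_nonneg (h1.add h2).hasFDerivWithinAt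
    (sub_mem_posTangentConeAt_of_segment_subset ((hG.convex_X i).segment_subset hu hw))
  simpa only [add_apply, InnerProductSpace.toDual_apply_apply, smul_apply, innerSL_apply_apply,
    smul_eq_mul, inner_add_left, real_inner_smul_left] using h4

theorem Assumptions.proxBR_spec (hG : G.Assumptions P M) (μ : ℝ) (i : Fin N) {y : Profile n}
    (hy : y ∈ G.feasible) :
    G.proxBR P μ i y ∈ G.X i ∧
      IsMinOn (fun u => G.cost P i (Function.update y i u) + μ / 2 * ‖u - y i‖ ^ 2) (G.X i)
        (G.proxBR P μ i y) := by
  refine Classical.epsilon_spec (p := fun v => v ∈ G.X i ∧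
    IsMinOn (fun u => G.cost P i (Function.update y i u) + μ / 2 * ‖u - y i‖ ^ 2) (G.X i) v) ?_
  refine (hG.compact_X i).exists_isMinOn ⟨y i, hy i⟩ ?_
  refine ContinuousOn.add (fun u hu => ?_) (by fun_prop)
  exact (hG.contDiffAt_cost hy hu).continuousAt.continuousWithinAt

theorem gammaMatrix_nonneg (hdd : G.DiagDominant P) {μ : ℝ} (hμ : 0 < μ) (i j : Fin N) :
    0 ≤ G.gammaMatrix P μ i j := by
  have := hdd.zetaMin_pos i
  have := G.zetaMax_nonneg P i j
  unfold gammaMatrix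
  split_ifs <;> positivity

theorem sum_gammaMatrix_le (hdd : G.DiagDominant P) {μ : ℝ} (hμ : 0 < μ) (i : Fin N) :
    ∑ j, G.gammaMatrix P μ i j ≤ G.aInf P μ := by
  unfold aInf
  let := Matrix.linftyOpNormedAddCommGroup (m := Fin N) (n := Fin N) (α := ℝ)
  change _ ≤ ‖G.gammaMatrix P μ‖
  rw [Matrix.linfty_opNorm_def]
  have h := Finset.le_sup (f := fun i => ∑ j, ‖G.gammaMatrix P μ i j‖₊) (Finset.mem_univ i)
  refine le_trans (le_of_eq ?_) (NNReal.coe_le_coe.2 h)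
  push_cast
  exact Finset.sum_congr rfl fun j _ => (Real.norm_of_nonneg (gammaMatrix_nonneg hdd hμ i j)).symm

/-- A row sum is `(μ + ∑ ζ_ij) / (μ + ζ_i,min)`, so this is exactly diagonal dominance. -/
theorem aInf_lt_one (hdd : G.DiagDominant P) {μ : ℝ} (hμ : 0 < μ) : G.aInf P μ < 1 := by
  unfold aInf
  let := Matrix.linftyOpNormedAddCommGroup (m := Fin N) (n := Fin N) (α := ℝ)
  change ‖G.gammaMatrix P μ‖ < 1
  rw [Matrix.linfty_opNorm_def, ← NNReal.coe_one, NNReal.coe_lt_coe,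
    Finset.sup_lt_iff (by simp)]
  intro i _
  rw [← NNReal.coe_lt_coe]
  push_cast
  have hpos := hdd.zetaMin_pos i
  rw [Finset.sum_congr rfl fun j _ => Real.norm_of_nonneg (gammaMatrix_nonneg hdd hμ i j),
    ← Finset.add_sum_erase _ _ (Finset.mem_univ i)]
  have h1 : ∑ j ∈ Finset.univ.erase i, G.gammaMatrix P μ i j =
      (∑ j ∈ Finset.univ.erase i, G.zetaMax P i j) / (μ + G.zetaMin P i) := by
    rw [Finset.sum_div]
    refine Finset.sum_congr rfl fun j hj => ?_
    simp [gammaMatrix, Finset.ne_of_mem_erase hj]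
  rw [h1]
  simp only [gammaMatrix, if_true]
  rw [← add_div, div_lt_one (by positivity)]
  linarith [(hdd i).2]

/-- Each variational inequality is tested at the other minimizer and the two are added; strong
monotonicity together with the proximal term leaves `μ + ζ_min` on the left. Arbitrary minimizers
are allowed, so that `x = y` also yields uniqueness. -/
theorem Assumptions.norm_minimizer_sub_le (hG : G.Assumptions P M) (hdd : G.DiagDominant P)
    {μ : ℝ} (hμ : 0 < μ) {i : Fin N} {x y : Profile n} (hx : x ∈ G.feasible)
    (hy : y ∈ G.feasible) {u v : Vec (n i)} (hu : u ∈ G.X i) (hv : v ∈ G.X i)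
    (humin : IsMinOn (fun u => G.cost P i (Function.update x i u) + μ / 2 * ‖u - x i‖ ^ 2)
      (G.X i) u)
    (hvmin : IsMinOn (fun u => G.cost P i (Function.update y i u) + μ / 2 * ‖u - y i‖ ^ 2)
      (G.X i) v) :
    ‖u - v‖ ≤ ∑ j, G.gammaMatrix P μ i j * ‖x j - y j‖ := by
  have hpos : 0 < μ + G.zetaMin P i := add_pos hμ (hdd.zetaMin_pos i)
  have h1 := hG.inner_nonneg_of_isMinOn hx hu humin hv
  have h2 := hG.inner_nonneg_of_isMinOn hy hv hvmin hu
  have h3 := hG.strongly_monotone hdd hx hu hv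
  have h4 := hG.norm_partialGrad_sub_le hdd (i := i) (update_mem_feasible hx hv)
    (update_mem_feasible hy hv) (by simp)
  set gu := partialGrad i (G.cost P i) (Function.update x i u)
  set gv := partialGrad i (G.cost P i) (Function.update x i v)
  set gv' := partialGrad i (G.cost P i) (Function.update y i v)
  have h4' : ‖gv - gv'‖ ≤ ∑ j ∈ Finset.univ.erase i, G.zetaMax P i j * ‖x j - y j‖ := by
    refine h4.trans (le_of_eq (Finset.sum_congr rfl fun j hj => ?_))
    rw [Function.update_of_ne (Finset.ne_of_mem_erase hj),
      Function.update_of_ne (Finset.ne_of_mem_erase hj)]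
  set s := ∑ j ∈ Finset.univ.erase i, G.zetaMax P i j * ‖x j - y j‖
  have h5 : ⟪gv - gv', v - u⟫ ≤ s * ‖u - v‖ := by
    rw [norm_sub_rev u v]
    exact (real_inner_le_norm _ _).trans (mul_le_mul_of_nonneg_right h4' (norm_nonneg _))
  have h6 : ⟪x i - y i, u - v⟫ ≤ ‖x i - y i‖ * ‖u - v‖ := real_inner_le_norm _ _
  have h7 : (μ + G.zetaMin P i) * ‖u - v‖ ^ 2 ≤ (μ * ‖x i - y i‖ + s) * ‖u - v‖ := by
    have e1 : ⟪gu + μ • (u - x i), v - u⟫ + ⟪gv' + μ • (v - y i), u - v⟫ =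
        -⟪gu - gv, u - v⟫ + ⟪gv - gv', v - u⟫ - μ * ‖u - v‖ ^ 2 + μ * ⟪x i - y i, u - v⟫ := by
      rw [← real_inner_self_eq_norm_sq]
      simp only [inner_add_left, inner_sub_left, inner_sub_right, real_inner_smul_left]
      ring
    nlinarith
  have h8 : (μ + G.zetaMin P i) * ‖u - v‖ ≤ μ * ‖x i - y i‖ + s := by
    rcases (norm_nonneg (u - v)).eq_or_lt with h0 | h0
    · rw [← h0, mul_zero]
      have : 0 ≤ s := (norm_nonneg _).trans h4'
      positivity
    · refine le_of_mul_le_mul_right ?_ h0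
      linarith [h7]
  have h9 : ∑ j, G.gammaMatrix P μ i j * ‖x j - y j‖ =
      (μ * ‖x i - y i‖ + s) / (μ + G.zetaMin P i) := by
    rw [← Finset.add_sum_erase _ _ (Finset.mem_univ i), add_div, Finset.sum_div]
    congr 1
    · simp [gammaMatrix]; ring
    · refine Finset.sum_congr rfl fun j hj => ?_
      simp [gammaMatrix, Finset.ne_of_mem_erase hj]; ring
  rw [h9, le_div_iff₀ hpos]
  linarith

theorem Assumptions.norm_proxBR_sub_le (hG : G.Assumptions P M) (hdd : G.DiagDominant P)
    {μ : ℝ} (hμ : 0 < μ) (i : Fin N) {x y : Profile n} (hx : x ∈ G.feasible)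
    (hy : y ∈ G.feasible) :
    ‖G.proxBR P μ i x - G.proxBR P μ i y‖ ≤ ∑ j, G.gammaMatrix P μ i j * ‖x j - y j‖ :=
  hG.norm_minimizer_sub_le hdd hμ hx hy (hG.proxBR_spec μ i hx).1 (hG.proxBR_spec μ i hy).1
    (hG.proxBR_spec μ i hx).2 (hG.proxBR_spec μ i hy).2

/-- At an equilibrium the proximal term vanishes at `x i`, so `x i` solves its own proximal problem;
uniqueness does the rest. -/
theorem Assumptions.proxBR_nash (hG : G.Assumptions P M) (hdd : G.DiagDominant P)
    {μ : ℝ} (hμ : 0 < μ) (i : Fin N) {x : Profile n} (hx : G.IsNash P x) :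
    G.proxBR P μ i x = x i := by
  have hmin : IsMinOn (fun u => G.cost P i (Function.update x i u) + μ / 2 * ‖u - x i‖ ^ 2)
      (G.X i) (x i) := by
    intro u hu
    have h := hx.2 i u hu
    have h' : 0 ≤ μ / 2 * ‖u - x i‖ ^ 2 := by positivity
    simp
    linarith
  have h := hG.norm_minimizer_sub_le hdd hμ hx.1 hx.1 (hG.proxBR_spec μ i hx.1).1 (hx.1 i)
    (hG.proxBR_spec μ i hx.1).2 hmin
  simp only [sub_self, norm_zero, mul_zero, Finset.sum_const_zero] at h
  exact sub_eq_zero.1 (norm_le_zero_iff.1 h)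

end Analysis

end Game

/-! ### Euclidean projections -/

section Projection

variable {m : ℕ} {K : Set (Vec m)}

theorem IsProj.inner_le_zero (hK : Convex ℝ K) {u v w : Vec m} (h : IsProj K u v) (hw : w ∈ K) :
    ⟪u - v, w - v⟫ ≤ 0 := by
  have : Nonempty K := ⟨⟨v, h.1⟩⟩
  refine (norm_eq_iInf_iff_real_inner_le_zero hK h.1).1 (le_antisymm ?_ ?_) w hw
  · exact le_ciInf fun w => h.2 w w.2
  · exact ciInf_le (f := fun w : K => ‖u - w‖) ⟨0, by rintro _ ⟨w, rfl⟩; exact norm_nonneg _⟩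
      ⟨v, h.1⟩

theorem IsProj.norm_sub_le (hK : Convex ℝ K) {u v u' v' : Vec m} (h : IsProj K u v)
    (h' : IsProj K u' v') : ‖v - v'‖ ≤ ‖u - u'‖ := by
  have h1 := h.inner_le_zero hK h'.1
  have h2 := h'.inner_le_zero hK h.1
  have h3 : ‖v - v'‖ ^ 2 ≤ ‖u - u'‖ * ‖v - v'‖ := by
    refine le_trans ?_ (real_inner_le_norm (u - u') (v - v'))
    rw [← real_inner_self_eq_norm_sq]
    have e : ⟪u - u', v - v'⟫ - ⟪v - v', v - v'⟫ = -⟪u - v, v' - v⟫ - ⟪u' - v', v - v'⟫ := by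
      simp only [inner_sub_left, inner_sub_right]
      ring
    linarith
  rcases (norm_nonneg (v - v')).eq_or_lt with h0 | h0
  · rw [← h0]; exact norm_nonneg _
  · refine le_of_mul_le_mul_right ?_ h0
    linarith [h3]

theorem isProj_self {u : Vec m} (hu : u ∈ K) : IsProj K u u :=
  ⟨hu, fun w _ => by simp⟩

/-- Nonexpansiveness forces any projection of `f ω` to be the value of one fixed `1`-Lipschitz map,
so no measurable selection is needed. -/
theorem IsProj.measurable {Ω : Type*} {mΩ : MeasurableSpace Ω} (hc : IsCompact K)
    (hK : Convex ℝ K) {f g : Ω → Vec m} (hf : Measurable f)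
    (h : ∀ ω, IsProj K (f ω) (g ω)) : Measurable g := by
  rcases K.eq_empty_or_nonempty with rfl | hne
  · have : IsEmpty Ω := ⟨fun ω => (h ω).1⟩
    exact measurable_of_empty g
  have hex : ∀ u, ∃ v, IsProj K u v := fun u => by
    obtain ⟨v, hv, hm⟩ := hc.exists_isMinOn (f := fun w => ‖u - w‖) hne (by fun_prop)
    exact ⟨v, hv, fun w hw => hm hw⟩
  choose p hp using hex
  have hlip : LipschitzWith 1 p := LipschitzWith.of_dist_le_mul fun u u' => by
    simpa [dist_eq_norm] using (hp u).norm_sub_le hK (hp u')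
  have hg : g = p ∘ f := by
    funext ω
    have := (h ω).norm_sub_le hK (hp (f ω))
    rw [sub_self, norm_zero] at this
    exact sub_eq_zero.1 (norm_le_zero_iff.1 this)
  rw [hg]
  exact hlip.continuous.measurable.comp hf

end Projection

/-! ### Measurability tools -/

theorem measurable_apply_of_countable {Ω ι β : Type*} {mΩ : MeasurableSpace Ω} [Countable ι]
    [MeasurableSpace ι] [MeasurableSingletonClass ι] {mβ : MeasurableSpace β} {τ : Ω → ι}
    (hτ : Measurable τ) {F : ι → Ω → β} (hF : ∀ s, Measurable (F s)) :
    Measurable fun ω => F (τ ω) ω := by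
  have h : Measurable (fun p : Ω × ι => F p.2 p.1) :=
    measurable_from_prod_countable_left fun s => hF s
  exact h.comp (measurable_id.prodMk hτ)

theorem measurable_profile_iff {N : ℕ} {n : Fin N → ℕ} {Ω : Type*} {m : MeasurableSpace Ω}
    {y : Ω → Profile n} : Measurable y ↔ ∀ j, Measurable fun ω => y ω j :=
  measurable_pi_iff

theorem measurable_update {N : ℕ} {n : Fin N → ℕ} {Ω : Type*} {m : MeasurableSpace Ω}
    {y : Ω → Profile n} (hy : Measurable y) {i : Fin N} {z : Ω → Vec (n i)} (hz : Measurable z) :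
    Measurable fun ω => Function.update (y ω) i (z ω) := by
  refine measurable_profile_iff.2 fun j => ?_
  rcases eq_or_ne j i with rfl | h
  · simpa using hz
  · simpa only [Function.update_of_ne h] using measurable_profile_iff.1 hy j

theorem measurable_comp_subtype {Ω α β : Type*} {m : MeasurableSpace Ω} [MeasurableSpace α]
    [MeasurableSpace β] {p : α → Prop} {F : α → β} (hF : Measurable fun x : {x // p x} => F x)
    {f : Ω → α} (hf : Measurable f) (hp : ∀ ω, p (f ω)) : Measurable fun ω => F (f ω) :=
  hF.comp (hf.subtype_mk (h := hp))

theorem measurable_comp_subtype_prod {Ω α β γ : Type*} {m : MeasurableSpace Ω}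
    [MeasurableSpace α] [MeasurableSpace β] [MeasurableSpace γ] {p : α → Prop} {F : α → γ → β}
    (hF : Measurable fun x : {x // p x} × γ => F x.1 x.2)
    {f : Ω → α} (hf : Measurable f) (hp : ∀ ω, p (f ω)) {g : Ω → γ} (hg : Measurable g) :
    Measurable fun ω => F (f ω) (g ω) :=
  hF.comp ((hf.subtype_mk (h := hp)).prodMk hg)

/-- The minimizer is picked by choice, but the contraction estimate makes it continuous on the
feasible set. -/
theorem Game.Assumptions.measurable_proxBR {N : ℕ} {n : Fin N → ℕ} {d : ℕ} {Ω : Type*}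
    [MeasurableSpace Ω] {G : Game n d Ω} {P : Measure Ω} {M : Fin N → ℝ}
    (hG : G.Assumptions P M) (hdd : G.DiagDominant P) {μ : ℝ} (hμ : 0 < μ) (i : Fin N) :
    Measurable fun y : {x : Profile n // x ∈ G.feasible} => G.proxBR P μ i y := by
  refine Continuous.measurable (continuous_iff_continuousAt.2 fun x => ?_)
  refine tendsto_iff_norm_sub_tendsto_zero.2 (squeeze_zero (fun _ => norm_nonneg _)
    (fun y => hG.norm_proxBR_sub_le hdd hμ i y.2 x.2) ?_)
  have hc : Continuous fun y : {x : Profile n // x ∈ G.feasible} =>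
      ∑ j, G.gammaMatrix P μ i j * ‖(y : Profile n) j - (x : Profile n) j‖ :=
    continuous_finsetSum _ fun j _ => continuous_const.mul
      ((((continuous_apply j).comp continuous_subtype_val).sub continuous_const).norm)
  simpa using hc.tendsto x

/-! ### Feasibility and adaptedness of the iterates -/

namespace Run

variable {N : ℕ} {n : Fin N → ℕ} {d : ℕ} {Ω : Type*} {G : Game n d Ω}
  {R : Run n d Ω}

theorem delayInfo_mono {S T : Set ℕ} (h : S ⊆ T) : R.delayInfo S ≤ R.delayInfo T :=
  biSup_mono h

theorem measurable_delay {S : Set ℕ} {l : ℕ} (hl : l ∈ S) {i : Fin N} (hi : i ∈ R.I l)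
    (j : Fin N) : Measurable[R.delayInfo S] (R.τ i j l) := by
  rw [measurable_iff_comap_le]
  exact le_iSup₂_of_le l hl (le_iSup₂_of_le i hi (le_iSup_of_le j le_rfl))

theorem measurable_sample_info {k l : ℕ} (hl : l < k) {i : Fin N} (hi : i ∈ R.I l) {t : ℕ}
    (ht : 1 ≤ t) (ht' : t ≤ R.steps i l) : Measurable[R.info k] (R.sample i l t) := by
  rw [measurable_iff_comap_le]
  refine le_sup_of_le_left (le_sup_of_le_right ?_)
  exact le_iSup₂_of_le l hl (le_iSup₂_of_le i hi (le_iSup₂_of_le t ⟨ht, ht'⟩ le_rfl))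

theorem info_mono : Monotone R.info := by
  intro k l h
  refine sup_le_sup (sup_le_sup le_rfl ?_) (delayInfo_mono (Set.Iic_subset_Iic.2 h))
  exact biSup_mono fun r hr => lt_of_lt_of_le hr h

theorem measurable_sample_oracleInfo {i : Fin N} {k t r : ℕ} (hr : 1 ≤ r) (hrt : r < t) :
    Measurable[R.oracleInfo i k t] (R.sample i k r) := by
  rw [measurable_iff_comap_le]
  exact le_sup_of_le_left (le_sup_of_le_right (le_iSup₂_of_le r ⟨hr, hrt⟩ le_rfl))

theorem info_le_oracleInfo (i : Fin N) (k t : ℕ) : R.info k ≤ R.oracleInfo i k t :=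
  le_sup_of_le_left le_sup_left

theorem measurable_y_of {m : MeasurableSpace Ω} {i : Fin N} {k : ℕ}
    (hx : ∀ l ≤ k, Measurable (R.x l)) (hτ : ∀ j, Measurable (R.τ i j k)) :
    Measurable (R.y i k) := by
  refine measurable_profile_iff.2 fun j => ?_
  exact measurable_apply_of_countable (hτ j) (F := fun s ω => R.x (k - s) ω j)
    fun s => measurable_profile_iff.1 (hx _ (Nat.sub_le _ _)) j

/-- The `σ`-field is left free because two are needed: `info (k + 1)` for the final iterate, and
`oracleInfo i k t`, which contains the samples before `t` only, for the query points. -/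
theorem measurable_z_of {m : MeasurableSpace Ω} {i : Fin N} {k : ℕ} {μ : ℝ}
    (hc : IsCompact (G.X i)) (hconv : Convex ℝ (G.X i))
    (hgrad : Measurable
      fun p : {x : Profile n // x ∈ G.feasible} × Vec d => G.sampleGrad i p.1 p.2)
    (hinit : ∀ ω, R.z i k 1 ω = R.x k ω i)
    (hstep : ∀ t, 1 ≤ t → t ≤ R.steps i k → ∀ ω, IsProj (G.X i)
      (R.z i k t ω - (1 / (μ * (t + 1))) •
        (G.sampleGrad i (Function.update (R.y i k ω) i (R.z i k t ω)) (R.sample i k t ω)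
          + μ • (R.z i k t ω - R.x k ω i)))
      (R.z i k (t + 1) ω))
    (hz : ∀ t, 1 ≤ t → t ≤ R.steps i k + 1 → ∀ ω, R.z i k t ω ∈ G.X i)
    (hy : ∀ ω, R.y i k ω ∈ G.feasible)
    (hx : Measurable (R.x k)) (hym : Measurable (R.y i k)) {t : ℕ} (ht : 1 ≤ t)
    (ht' : t ≤ R.steps i k + 1) (hs : ∀ r, 1 ≤ r → r < t → Measurable (R.sample i k r)) :
    Measurable (R.z i k t) := by
  have hxi : Measurable fun ω => R.x k ω i := measurable_profile_iff.1 hx i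
  induction t, ht using Nat.le_induction with
  | base =>
    have : R.z i k 1 = fun ω => R.x k ω i := funext hinit
    rwa [this]
  | succ t ht ih =>
    have hzt := ih (by omega) fun r h1 h2 => hs r h1 (by omega)
    refine IsProj.measurable hc hconv ?_ (hstep t ht (by omega))
    have hg := measurable_comp_subtype_prod (F := fun x s => G.sampleGrad i x s) hgrad
      (measurable_update hym hzt)
      (fun ω => Game.update_mem_feasible (hy ω) (hz t ht (by omega) ω)) (hs t ht (by omega))
    exact hzt.sub ((hg.add ((hzt.sub hxi).const_smul μ)).const_smul (1 / (μ * ((t : ℝ) + 1))))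

variable [MeasurableSpace Ω] {P : Measure Ω} {M : Fin N → ℝ} {B₁ B₂ : ℕ} {μ : ℝ}

theorem IsExecution.z_mem_of (hexec : R.IsExecution G P μ) {k : ℕ}
    (hx : ∀ ω, R.x k ω ∈ G.feasible) {i : Fin N} (hi : i ∈ R.I k) {t : ℕ} (ht : 1 ≤ t)
    (ht' : t ≤ R.steps i k + 1) (ω : Ω) : R.z i k t ω ∈ G.X i := by
  rcases ht.eq_or_lt with rfl | h
  · rw [hexec.inner_init k i hi]; exact hx ω i
  · obtain ⟨s, rfl⟩ : ∃ s, t = s + 1 := ⟨t - 1, by omega⟩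
    exact (hexec.inner_step k i hi s (by omega) (by omega) ω).1

theorem IsExecution.x_mem (hexec : R.IsExecution G P μ) (k : ℕ) (ω : Ω) :
    R.x k ω ∈ G.feasible := by
  induction k generalizing ω with
  | zero => exact hexec.init_mem ω
  | succ k ih =>
    intro i
    by_cases hi : i ∈ R.I k
    · rw [hexec.update k i hi]
      exact hexec.z_mem_of ih hi (by omega) le_rfl ω
    · rw [hexec.no_update k i hi]
      exact ih ω i

theorem IsExecution.z_mem (hexec : R.IsExecution G P μ) {k : ℕ} {i : Fin N} (hi : i ∈ R.I k)
    {t : ℕ} (ht : 1 ≤ t) (ht' : t ≤ R.steps i k + 1) (ω : Ω) : R.z i k t ω ∈ G.X i :=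
  hexec.z_mem_of (hexec.x_mem k) hi ht ht' ω

theorem IsExecution.y_mem (hexec : R.IsExecution G P μ) (i : Fin N) (k : ℕ) (ω : Ω) :
    R.y i k ω ∈ G.feasible :=
  fun j => hexec.x_mem _ ω j

theorem Protocol.y_self (hR : R.Protocol P B₁ B₂) {k : ℕ} {i : Fin N} (hi : i ∈ R.I k) (ω : Ω) :
    R.y i k ω i = R.x k ω i := by
  simp [y, hR.delay_self k i hi ω]

theorem Protocol.delayInfo_le (hR : R.Protocol P B₁ B₂) (S : Set ℕ) :
    R.delayInfo S ≤ (inferInstance : MeasurableSpace Ω) :=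
  iSup₂_le fun l _ => iSup₂_le fun i _ => iSup_le fun j => (hR.measurable_τ i j l).comap_le

theorem IsExecution.info_le (hexec : R.IsExecution G P μ) (hR : R.Protocol P B₁ B₂) (k : ℕ) :
    R.info k ≤ (inferInstance : MeasurableSpace Ω) :=
  sup_le (sup_le hexec.measurable_init.comap_le (iSup₂_le fun l _ => iSup₂_le fun i _ =>
    iSup₂_le fun t _ => (hexec.measurable_sample i l t).comap_le)) (hR.delayInfo_le _)

theorem IsExecution.oracleInfo_le (hexec : R.IsExecution G P μ) (hR : R.Protocol P B₁ B₂)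
    (i : Fin N) (k t : ℕ) : R.oracleInfo i k t ≤ (inferInstance : MeasurableSpace Ω) :=
  sup_le (sup_le (hexec.info_le hR k) (iSup₂_le fun r _ =>
    (hexec.measurable_sample i k r).comap_le)) (hR.delayInfo_le _)

theorem IsExecution.measurable_x (hexec : R.IsExecution G P μ) (hG : G.Assumptions P M) (k : ℕ) :
    Measurable[R.info k] (R.x k) := by
  induction k using Nat.strong_induction_on with
  | _ k ih =>
    rcases k with _ | k
    · rw [measurable_iff_comap_le]
      exact le_sup_of_le_left le_sup_left
    · have hx : ∀ l ≤ k, Measurable[R.info (k + 1)] (R.x l) := fun l hl =>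
        (ih l (by omega)).mono (info_mono (by omega)) le_rfl
      refine measurable_profile_iff.2 fun i => ?_
      by_cases hi : i ∈ R.I k
      · have h : (fun ω => R.x (k + 1) ω i) = R.z i k (R.steps i k + 1) :=
          funext (hexec.update k i hi)
        rw [h]
        refine measurable_z_of (hG.compact_X i) (hG.convex_X i) (hG.measurable_sampleGrad i)
          (hexec.inner_init k i hi) (hexec.inner_step k i hi)
          (fun _ h1 h2 => hexec.z_mem hi h1 h2) (hexec.y_mem i k)
          (hx k le_rfl) (measurable_y_of hx fun j => ?_)
          (by omega) le_rfl fun r h1 h2 => measurable_sample_info (by omega) hi h1 (by omega)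
        exact (measurable_delay (S := Set.Iic (k + 1)) (by simp) hi j).mono le_sup_right le_rfl
      · have h : (fun ω => R.x (k + 1) ω i) = fun ω => R.x k ω i :=
          funext (hexec.no_update k i hi)
        rw [h]
        exact measurable_profile_iff.1 (hx k le_rfl) i

theorem IsExecution.measurable_y (hexec : R.IsExecution G P μ) (hG : G.Assumptions P M) {k : ℕ}
    {i : Fin N} (hi : i ∈ R.I k) : Measurable[R.info k] (R.y i k) :=
  measurable_y_of (fun l hl => (hexec.measurable_x hG l).mono (info_mono hl) le_rfl) fun j =>
    (measurable_delay (S := Set.Iic k) (by simp) hi j).mono le_sup_right le_rfl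

theorem IsExecution.measurable_z (hexec : R.IsExecution G P μ) (hG : G.Assumptions P M) {k : ℕ}
    {i : Fin N} (hi : i ∈ R.I k) {t : ℕ} (ht : 1 ≤ t) (ht' : t ≤ R.steps i k + 1) :
    Measurable[R.oracleInfo i k t] (R.z i k t) :=
  measurable_z_of (hG.compact_X i) (hG.convex_X i) (hG.measurable_sampleGrad i)
    (hexec.inner_init k i hi) (hexec.inner_step k i hi)
    (fun _ h1 h2 => hexec.z_mem hi h1 h2) (hexec.y_mem i k)
    ((hexec.measurable_x hG k).mono (info_le_oracleInfo i k t) le_rfl)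
    ((hexec.measurable_y hG hi).mono (info_le_oracleInfo i k t) le_rfl) ht ht'
    fun _ h1 h2 => measurable_sample_oracleInfo h1 h2

theorem IsExecution.measurable_proxBR_y (hexec : R.IsExecution G P μ) (hG : G.Assumptions P M)
    (hdd : G.DiagDominant P) (hμ : 0 < μ) {k : ℕ} {i : Fin N} (hi : i ∈ R.I k) :
    Measurable[R.info k] fun ω => G.proxBR P μ i (R.y i k ω) :=
  measurable_comp_subtype (hG.measurable_proxBR hdd hμ i) (hexec.measurable_y hG hi)
    (hexec.y_mem i k)

end Run

/-! ### Mean square error of the inner loop -/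

/-- One projected gradient step at distance `‖w - b‖` of a point `b` of the constraint set. -/
theorem IsProj.norm_sub_sq_le {m : ℕ} {K : Set (Vec m)} (hK : Convex ℝ K) {w g v z b : Vec m}
    {γ μ D : ℝ} (h : IsProj K (w - γ • (g + μ • v)) z) (hb : b ∈ K) (hv : ‖v‖ ≤ D) :
    ‖z - b‖ ^ 2 ≤ ‖w - b‖ ^ 2 - 2 * γ * μ * ⟪v, w - b⟫ + γ ^ 2 * (2 * μ ^ 2 * D ^ 2)
      - 2 * γ * ⟪g, w - b⟫ + 2 * γ ^ 2 * ‖g‖ ^ 2 := by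
  have h1 : ‖z - b‖ ^ 2 ≤ ‖w - γ • (g + μ • v) - b‖ ^ 2 := by
    gcongr
    exact h.norm_sub_le hK (isProj_self hb)
  have h2 : ‖w - γ • (g + μ • v) - b‖ ^ 2 =
      ‖w - b‖ ^ 2 - 2 * γ * (⟪g, w - b⟫ + μ * ⟪v, w - b⟫) + γ ^ 2 * ‖g + μ • v‖ ^ 2 := by
    rw [sub_right_comm, norm_sub_sq_real, real_inner_smul_right, real_inner_comm,
      inner_add_left, real_inner_smul_left, norm_smul, mul_pow, Real.norm_eq_abs, sq_abs]
    ring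
  -- This use of `(a + b)² ≤ 2a² + 2b²` is the origin of both factors `2` in `Q`.
  have h3 : ‖g + μ • v‖ ^ 2 ≤ 2 * ‖g‖ ^ 2 + 2 * μ ^ 2 * D ^ 2 := by
    have h4 : ‖g + μ • v‖ ≤ ‖g‖ + |μ| * D := by
      refine (norm_add_le _ _).trans (add_le_add_right ?_ _)
      rw [norm_smul, Real.norm_eq_abs]
      gcongr
    have h5 : ‖g + μ • v‖ ^ 2 ≤ (‖g‖ + |μ| * D) ^ 2 := by gcongr
    have h6 : (|μ| * D) ^ 2 = μ ^ 2 * D ^ 2 := by rw [mul_pow, sq_abs]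
    nlinarith [sq_nonneg (‖g‖ - |μ| * D)]
  have h7 := mul_le_mul_of_nonneg_left h3 (sq_nonneg γ)
  linarith

theorem setIntegral_sub_mul_add_mul {Ω : Type*} [MeasurableSpace Ω] {P : Measure Ω}
    {f g h : Ω → ℝ} (hf : Integrable f P) (hg : Integrable g P) (hh : Integrable h P) (r s : ℝ)
    {A : Set Ω} :
    ∫ ω in A, (f ω - r * g ω + s * h ω) ∂P =
      ∫ ω in A, f ω ∂P - r * ∫ ω in A, g ω ∂P + s * ∫ ω in A, h ω ∂P := by
  have h1 : IntegrableOn (fun ω => f ω - r * g ω) A P := (hf.sub (hg.const_mul r)).integrableOn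
  rw [integral_add h1 (hh.const_mul s).integrableOn,
    integral_sub hf.integrableOn (hg.const_mul r).integrableOn, integral_const_mul,
    integral_const_mul]

theorem condExp_inner_right {Ω : Type*} {m mΩ : MeasurableSpace Ω} {P : Measure Ω} {r : ℕ}
    {g h : Ω → Vec r} (hh : StronglyMeasurable[m] h) (hgh : Integrable (fun ω => ⟪g ω, h ω⟫) P)
    (hg : Integrable g P) :
    P[fun ω => ⟪g ω, h ω⟫ | m] =ᵐ[P] fun ω => ⟪(P[g | m]) ω, h ω⟫ :=
  condExp_bilin_of_stronglyMeasurable_right (innerSL ℝ) hh hgh hg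

namespace Game

variable {N : ℕ} {n : Fin N → ℕ} {d : ℕ} {Ω : Type*} [MeasurableSpace Ω] {P : Measure Ω}
  {G : Game n d Ω} {M : Fin N → ℝ}

theorem Assumptions.norm_sub_le_diam (hG : G.Assumptions P M) {i : Fin N} {u v : Vec (n i)}
    (hu : u ∈ G.X i) (hv : v ∈ G.X i) : ‖u - v‖ ≤ Metric.diam (G.X i) := by
  rw [← dist_eq_norm]
  exact Metric.dist_le_diam_of_mem (hG.compact_X i).isBounded hu hv

theorem Assumptions.Q_pos (hG : G.Assumptions P M) {μ : ℝ} (hμ : 0 < μ) (i : Fin N) :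
    0 < G.Q M μ i := by
  have := hG.M_pos i
  unfold Q
  positivity

/-- Strong monotonicity of the gradient of the proximal objective at its minimizer. -/
theorem Assumptions.mul_norm_sub_proxBR_sq_le (hG : G.Assumptions P M) (hdd : G.DiagDominant P)
    (μ : ℝ) {i : Fin N} {y : Profile n} (hy : y ∈ G.feasible) {u : Vec (n i)} (hu : u ∈ G.X i) :
    μ * ‖u - G.proxBR P μ i y‖ ^ 2 ≤
      ⟪partialGrad i (G.cost P i) (Function.update y i u), u - G.proxBR P μ i y⟫ +
        μ * ⟪u - y i, u - G.proxBR P μ i y⟫ := by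
  obtain ⟨hb, hmin⟩ := hG.proxBR_spec μ i hy
  set b := G.proxBR P μ i y
  have h1 := hG.inner_nonneg_of_isMinOn hy hb hmin hu
  have h2 := hG.strongly_monotone hdd hy hu hb
  have h3 : 0 ≤ G.zetaMin P i * ‖u - b‖ ^ 2 :=
    mul_nonneg (hdd.zetaMin_pos i).le (by positivity)
  set g := partialGrad i (G.cost P i) (Function.update y i u)
  set g' := partialGrad i (G.cost P i) (Function.update y i b)
  have e : ⟪g, u - b⟫ + μ * ⟪u - y i, u - b⟫ - μ * ‖u - b‖ ^ 2 =
      ⟪g - g', u - b⟫ + ⟪g' + μ • (b - y i), u - b⟫ := by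
    rw [← real_inner_self_eq_norm_sq]
    simp only [inner_add_left, inner_sub_left, real_inner_smul_left]
    ring
  linarith

end Game

namespace Run

variable {N : ℕ} {n : Fin N → ℕ} {d : ℕ} {Ω : Type*} [MeasurableSpace Ω] {P : Measure Ω}
  [IsProbabilityMeasure P] {G : Game n d Ω} {M : Fin N → ℝ} {R : Run n d Ω} {B₁ B₂ : ℕ} {μ : ℝ}

theorem IsExecution.integrable_norm_sub_sq (hexec : R.IsExecution G P μ)
    (hG : G.Assumptions P M) (hdd : G.DiagDominant P) (hμ : 0 < μ) (hR : R.Protocol P B₁ B₂)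
    {k : ℕ} {i : Fin N} (hi : i ∈ R.I k) {t : ℕ} (ht : 1 ≤ t) (ht' : t ≤ R.steps i k + 1) :
    Integrable (fun ω => ‖R.z i k t ω - G.proxBR P μ i (R.y i k ω)‖ ^ 2) P := by
  have hz := (hexec.measurable_z hG hi ht ht').mono (hexec.oracleInfo_le hR i k t) le_rfl
  have hb := (hexec.measurable_proxBR_y hG hdd hμ hi).mono (hexec.info_le hR k) le_rfl
  refine Integrable.of_bound ((hz.sub hb).norm.pow_const 2).aestronglyMeasurable
    (Metric.diam (G.X i) ^ 2) (Filter.Eventually.of_forall fun ω => ?_)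
  rw [Real.norm_of_nonneg (by positivity)]
  gcongr
  exact hG.norm_sub_le_diam (hexec.z_mem hi ht ht' ω) (hG.proxBR_spec μ i (hexec.y_mem i k ω)).1

/-- On an event of the oracle `σ`-field the direction to the best response is known, so unbiasedness
replaces the sampled gradient by the true one, and strong monotonicity supplies the contraction. -/
theorem IsExecution.setIntegral_step_le (hexec : R.IsExecution G P μ) (horacle : R.Oracle G P)
    (hG : G.Assumptions P M) (hdd : G.DiagDominant P) (hμ : 0 < μ) (hR : R.Protocol P B₁ B₂)
    {k : ℕ} {i : Fin N} (hi : i ∈ R.I k) {t : ℕ} (ht : 1 ≤ t) (ht' : t ≤ R.steps i k)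
    {A : Set Ω} (hA : MeasurableSet[R.oracleInfo i k t] A) :
    ∫ ω in A, ‖R.z i k (t + 1) ω - G.proxBR P μ i (R.y i k ω)‖ ^ 2 ∂P ≤
      (1 - 2 / ((t : ℝ) + 1)) * ∫ ω in A, ‖R.z i k t ω - G.proxBR P μ i (R.y i k ω)‖ ^ 2 ∂P +
        G.Q M μ i / ((t : ℝ) + 1) ^ 2 * P.real A := by
  have hm := hexec.oracleInfo_le hR i k t
  set γ : ℝ := 1 / (μ * ((t : ℝ) + 1)) with hγ
  have hγpos : 0 < γ := by positivity
  set D := Metric.diam (G.X i) with hD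
  have hD0 : 0 ≤ D := Metric.diam_nonneg
  set b : Ω → Vec (n i) := fun ω => G.proxBR P μ i (R.y i k ω) with hb
  set q : Ω → Profile n := fun ω => Function.update (R.y i k ω) i (R.z i k t ω) with hq
  set g : Ω → Vec (n i) := fun ω => G.sampleGrad i (q ω) (R.sample i k t ω) with hg
  set h : Ω → Vec (n i) := fun ω => R.z i k t ω - b ω with hh
  set v : Ω → Vec (n i) := fun ω => R.z i k t ω - R.x k ω i with hv
  have hzm := hexec.measurable_z hG hi ht (ht'.trans (Nat.le_succ _))
  have hbm := (hexec.measurable_proxBR_y hG hdd hμ hi).mono (info_le_oracleInfo i k t) le_rfl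
  have hxm := measurable_profile_iff.1
    ((hexec.measurable_x hG k).mono (info_le_oracleInfo i k t) le_rfl) i
  have hym := (hexec.measurable_y hG hi).mono (hexec.info_le hR k) le_rfl
  have hhm : Measurable[R.oracleInfo i k t] h := hzm.sub hbm
  have hhm' := hhm.mono hm le_rfl
  have hvm' := (hzm.sub hxm).mono hm le_rfl
  have hzX : ∀ ω, R.z i k t ω ∈ G.X i := hexec.z_mem hi ht (ht'.trans (Nat.le_succ _))
  have hbX : ∀ ω, b ω ∈ G.X i := fun ω => (hG.proxBR_spec μ i (hexec.y_mem i k ω)).1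
  have hqX : ∀ ω, q ω ∈ G.feasible := fun ω =>
    Game.update_mem_feasible (hexec.y_mem i k ω) (hzX ω)
  have hgm : Measurable g := measurable_comp_subtype_prod (F := fun x s => G.sampleGrad i x s)
    (hG.measurable_sampleGrad i) (measurable_update hym (hzm.mono hm le_rfl)) hqX
    (hexec.measurable_sample i k t)
  have hhD : ∀ ω, ‖h ω‖ ≤ D := fun ω => hG.norm_sub_le_diam (hzX ω) (hbX ω)
  have hvD : ∀ ω, ‖v ω‖ ≤ D := fun ω => hG.norm_sub_le_diam (hzX ω) (hexec.x_mem k ω i)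
  have hg2 : Integrable (fun ω => ‖g ω‖ ^ 2) P := horacle.integrable_sq k i hi t ht ht'
  have hgL2 : MemLp g 2 P :=
    (memLp_two_iff_integrable_sq_norm hgm.aestronglyMeasurable).2 hg2
  have hg1 : Integrable g P := hgL2.integrable one_le_two
  have hgh : Integrable (fun ω => ⟪g ω, h ω⟫) P := by
    refine Integrable.mono' (hg1.norm.mul_const D) (hgm.inner hhm').aestronglyMeasurable
      (Filter.Eventually.of_forall fun ω => ?_)
    exact (norm_inner_le_norm _ _).trans (mul_le_mul_of_nonneg_left (hhD ω) (norm_nonneg _))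
  have hh2 : Integrable (fun ω => ‖h ω‖ ^ 2) P :=
    hexec.integrable_norm_sub_sq hG hdd hμ hR hi ht (ht'.trans (Nat.le_succ _))
  have hvh : Integrable (fun ω => ⟪v ω, h ω⟫) P := by
    refine Integrable.of_bound (hvm'.inner hhm').aestronglyMeasurable (D * D)
      (Filter.Eventually.of_forall fun ω => ?_)
    exact (norm_inner_le_norm _ _).trans
      (mul_le_mul (hvD ω) (hhD ω) (norm_nonneg _) hD0)
  have hu : Integrable (fun ω => ‖h ω‖ ^ 2 - 2 * γ * μ * ⟪v ω, h ω⟫ +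
      γ ^ 2 * (2 * μ ^ 2 * D ^ 2)) P := (hh2.sub (hvh.const_mul _)).add (integrable_const _)
  have hce1 := condExp_inner_right (hhm.stronglyMeasurable) hgh hg1
  have hce2 : P[g | R.oracleInfo i k t] =ᵐ[P] _ := horacle.unbiased k i hi t ht ht'
  have hce3 : P[fun ω => ‖g ω‖ ^ 2 | R.oracleInfo i k t] =ᵐ[P] _ :=
    horacle.second_moment k i hi t ht ht'
  set G' := P[fun ω => ⟪g ω, h ω⟫ | R.oracleInfo i k t] with hG'
  set S' := P[fun ω => ‖g ω‖ ^ 2 | R.oracleInfo i k t] with hS'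
  have hGi : Integrable G' P := integrable_condExp
  have hSi : Integrable S' P := integrable_condExp
  have hQ : γ ^ 2 * (2 * μ ^ 2 * D ^ 2) + 2 * γ ^ 2 * M i ^ 2 =
      G.Q M μ i / ((t : ℝ) + 1) ^ 2 := by
    rw [hγ, Game.Q, ← hD]
    field_simp
    ring
  have hγμ : 2 * γ * μ = 2 / ((t : ℝ) + 1) := by
    rw [hγ]
    field_simp
  calc ∫ ω in A, ‖R.z i k (t + 1) ω - b ω‖ ^ 2 ∂P
      ≤ ∫ ω in A, (‖h ω‖ ^ 2 - 2 * γ * μ * ⟪v ω, h ω⟫ + γ ^ 2 * (2 * μ ^ 2 * D ^ 2)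
          - 2 * γ * ⟪g ω, h ω⟫ + 2 * γ ^ 2 * ‖g ω‖ ^ 2) ∂P := by
        refine setIntegral_mono
          (hexec.integrable_norm_sub_sq hG hdd hμ hR hi (by omega) (by omega)).integrableOn
          (((hu.sub (hgh.const_mul _)).add (hg2.const_mul _))).integrableOn fun ω => ?_
        exact (hexec.inner_step k i hi t ht ht' ω).norm_sub_sq_le (hG.convex_X i) (hbX ω) (hvD ω)
    _ = ∫ ω in A, (‖h ω‖ ^ 2 - 2 * γ * μ * ⟪v ω, h ω⟫ + γ ^ 2 * (2 * μ ^ 2 * D ^ 2)) ∂P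
          - 2 * γ * ∫ ω in A, ⟪g ω, h ω⟫ ∂P + 2 * γ ^ 2 * ∫ ω in A, ‖g ω‖ ^ 2 ∂P := by
        exact setIntegral_sub_mul_add_mul hu hgh hg2 _ _
    -- A conditional expectation has the same integral over `A` as the original function.
    _ = ∫ ω in A, (‖h ω‖ ^ 2 - 2 * γ * μ * ⟪v ω, h ω⟫ + γ ^ 2 * (2 * μ ^ 2 * D ^ 2)) ∂P
          - 2 * γ * ∫ ω in A, G' ω ∂P + 2 * γ ^ 2 * ∫ ω in A, S' ω ∂P := by
        rw [hG', hS', setIntegral_condExp hm hgh hA, setIntegral_condExp hm hg2 hA]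
    _ = ∫ ω in A, (‖h ω‖ ^ 2 - 2 * γ * μ * ⟪v ω, h ω⟫ + γ ^ 2 * (2 * μ ^ 2 * D ^ 2)
          - 2 * γ * G' ω + 2 * γ ^ 2 * S' ω) ∂P := by
        exact (setIntegral_sub_mul_add_mul hu hGi hSi _ _).symm
    _ ≤ ∫ ω in A, ((1 - 2 / ((t : ℝ) + 1)) * ‖h ω‖ ^ 2 + G.Q M μ i / ((t : ℝ) + 1) ^ 2) ∂P := by
        refine setIntegral_mono_ae
          ((hu.sub (hGi.const_mul _)).add (hSi.const_mul _)).integrableOn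
          ((hh2.const_mul _).add (integrable_const _)).integrableOn ?_
        filter_upwards [hce1, hce2, hce3] with ω h1 h2 h3
        have h4 := hG.mul_norm_sub_proxBR_sq_le hdd μ (hexec.y_mem i k ω) (hzX ω)
        rw [hR.y_self hi] at h4
        change μ * ‖h ω‖ ^ 2 ≤ ⟪_, h ω⟫ + μ * ⟪v ω, h ω⟫ at h4
        rw [h2] at h1
        rw [← h1] at h4
        have h5 : S' ω ≤ M i ^ 2 := h3.trans_le (hG.second_moment i _ (hqX ω)).2
        rw [← hQ, ← hγμ]
        have h6 := mul_le_mul_of_nonneg_left h4 (by positivity : (0 : ℝ) ≤ 2 * γ)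
        have h7 := mul_le_mul_of_nonneg_left h5 (by positivity : (0 : ℝ) ≤ 2 * γ ^ 2)
        linarith
    _ = _ := by
        rw [integral_add (hh2.const_mul _).integrableOn (integrable_const _).integrableOn,
          integral_const_mul, setIntegral_const, smul_eq_mul, mul_comm (P.real A)]

/-- The event `A` is known before the inner loop starts, hence lies in the oracle `σ`-field of every
step, and the one-step recursion can be iterated on the same `A`. -/
theorem IsExecution.setIntegral_norm_sub_proxBR_sq_le (hexec : R.IsExecution G P μ)
    (horacle : R.Oracle G P) (hG : G.Assumptions P M) (hdd : G.DiagDominant P) (hμ : 0 < μ)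
    (hR : R.Protocol P B₁ B₂) {k : ℕ} {i : Fin N} (hi : i ∈ R.I k) {t : ℕ} (ht : 1 ≤ t)
    (ht' : t ≤ R.steps i k + 1) {A : Set Ω}
    (hA : MeasurableSet[R.info k ⊔ R.delayInfo Set.univ] A) :
    ∫ ω in A, ‖R.z i k t ω - G.proxBR P μ i (R.y i k ω)‖ ^ 2 ∂P ≤
      G.Q M μ i / t * P.real A := by
  have hQ0 := (hG.Q_pos hμ i).le
  have hA' : ∀ t, MeasurableSet[R.oracleInfo i k t] A := fun t =>
    (sup_le_sup le_sup_left le_rfl : R.info k ⊔ R.delayInfo Set.univ ≤ R.oracleInfo i k t) A hA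
  induction t, ht using Nat.le_induction with
  | base =>
    rw [Nat.cast_one, div_one, mul_comm, ← smul_eq_mul, ← setIntegral_const]
    refine setIntegral_mono (hexec.integrable_norm_sub_sq hG hdd hμ hR hi le_rfl ht').integrableOn
      (integrable_const _).integrableOn fun ω => ?_
    have h1 := hG.norm_sub_le_diam (hexec.z_mem hi le_rfl ht' ω)
      (hG.proxBR_spec μ i (hexec.y_mem i k ω)).1
    have h2 : ‖R.z i k 1 ω - G.proxBR P μ i (R.y i k ω)‖ ^ 2 ≤ Metric.diam (G.X i) ^ 2 := by
      gcongr
    have h3 : 0 ≤ 2 * M i ^ 2 / μ ^ 2 := by positivity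
    simp only [Game.Q]
    linarith [sq_nonneg (Metric.diam (G.X i))]
  | succ t ht ih =>
    have h1 := hexec.setIntegral_step_le horacle hG hdd hμ hR hi ht (by omega) (hA' t)
    have h2 := ih (by omega)
    have ht1 : (1 : ℝ) ≤ t := by exact_mod_cast ht
    have h3 : 0 ≤ 1 - 2 / ((t : ℝ) + 1) := by
      rw [sub_nonneg, div_le_one (by positivity)]
      linarith
    refine h1.trans ((add_le_add_left (mul_le_mul_of_nonneg_left h2 h3) _).trans ?_)
    rw [← mul_assoc, ← add_mul]
    refine mul_le_mul_of_nonneg_right ?_ measureReal_nonneg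
    push_cast
    -- The bound `Q/t` reproduces itself under the recursion, with slack `Q / (t (t+1)²)`.
    have e : G.Q M μ i / (t + 1) - ((1 - 2 / ((t : ℝ) + 1)) * (G.Q M μ i / t) +
        G.Q M μ i / ((t : ℝ) + 1) ^ 2) = G.Q M μ i / (t * (t + 1) ^ 2) := by
      have : (t : ℝ) ≠ 0 := by positivity
      field_simp
      ring
    have : 0 ≤ G.Q M μ i / (t * ((t : ℝ) + 1) ^ 2) := by positivity
    linarith

/-- Mean square error of the inexact best response, on every event of the past and the delays. -/
theorem IsExecution.setIntegral_error_sq_le (hexec : R.IsExecution G P μ)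
    (horacle : R.Oracle G P) (hG : G.Assumptions P M) (hdd : G.DiagDominant P) (hμ : 0 < μ)
    (hR : R.Protocol P B₁ B₂) {α : ℝ} (hα : 0 < α) {k : ℕ} {i : Fin N} (hi : i ∈ R.I k)
    (hsteps : G.Q M μ i / α ^ 2 ≤ (R.steps i k : ℝ) + 1) {A : Set Ω}
    (hA : MeasurableSet[R.info k ⊔ R.delayInfo Set.univ] A) :
    ∫ ω in A, ‖R.x (k + 1) ω i - G.proxBR P μ i (R.y i k ω)‖ ^ 2 ∂P ≤ α ^ 2 * P.real A := by
  have h := hexec.setIntegral_norm_sub_proxBR_sq_le horacle hG hdd hμ hR hi (by omega) le_rfl hA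
  simp_rw [hexec.update k i hi]
  refine h.trans (mul_le_mul_of_nonneg_right ?_ measureReal_nonneg)
  push_cast
  rw [div_le_iff₀ (by positivity)] at hsteps ⊢
  linarith

theorem IsExecution.integrable_error_sq (hexec : R.IsExecution G P μ)
    (hG : G.Assumptions P M) (hdd : G.DiagDominant P) (hμ : 0 < μ) (hR : R.Protocol P B₁ B₂)
    {k : ℕ} {i : Fin N} (hi : i ∈ R.I k) :
    Integrable (fun ω => ‖R.x (k + 1) ω i - G.proxBR P μ i (R.y i k ω)‖ ^ 2) P := by
  simp_rw [hexec.update k i hi]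
  exact hexec.integrable_norm_sub_sq hG hdd hμ hR hi (by omega) le_rfl

theorem IsExecution.condExp_error_sq_le (hexec : R.IsExecution G P μ)
    (horacle : R.Oracle G P) (hG : G.Assumptions P M) (hdd : G.DiagDominant P) (hμ : 0 < μ)
    (hR : R.Protocol P B₁ B₂) {α : ℝ} (hα : 0 < α) {k : ℕ} {i : Fin N} (hi : i ∈ R.I k)
    (hsteps : G.Q M μ i / α ^ 2 ≤ (R.steps i k : ℝ) + 1) :
    P[fun ω => ‖R.x (k + 1) ω i - G.proxBR P μ i (R.y i k ω)‖ ^ 2 | R.info k] ≤ᵐ[P]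
      fun _ => α ^ 2 := by
  have hm := hexec.info_le hR k
  have hint := hexec.integrable_error_sq hG hdd hμ hR hi
  -- Inequalities between integrals over all events of `info k` become an almost sure inequality for
  -- the measure restricted to that `σ`-field.
  refine ae_le_of_ae_le_trim (hm := hm) (ae_le_of_forall_setIntegral_le
    (integrable_condExp.trim hm stronglyMeasurable_condExp) (integrable_const _) ?_)
  intro A hA _
  rw [← setIntegral_trim hm stronglyMeasurable_condExp hA, setIntegral_condExp hm hint hA,
    ← setIntegral_trim hm stronglyMeasurable_const hA, setIntegral_const, smul_eq_mul, mul_comm]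
  exact hexec.setIntegral_error_sq_le horacle hG hdd hμ hR hα hi hsteps
    ((le_sup_left : R.info k ≤ _) A hA)

end Run

/-! ### Random delays and the outer recursion -/

theorem measurable_norm_sub {N : ℕ} {n : Fin N → ℕ} {Ω : Type*} {m : MeasurableSpace Ω}
    {x : Ω → Profile n} (hx : Measurable x) (i : Fin N) (c : Vec (n i)) :
    Measurable fun ω => ‖x ω i - c‖ :=
  ((measurable_profile_iff.1 hx i).sub_const c).norm

/-- On `A ∩ {τ = s}` the index is constant; the bounds add up because they are proportional to the
probability of the piece. -/
theorem setIntegral_random_index_le {Ω : Type*} [MeasurableSpace Ω] {P : Measure Ω}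
    [IsFiniteMeasure P] {τ : Ω → ℕ} (hτ : Measurable τ) {L : ℕ} (hL : ∀ ω, τ ω ≤ L)
    {F : ℕ → Ω → ℝ} (hF : ∀ s ≤ L, Integrable (F s) P) {A : Set Ω} (hA : MeasurableSet A) {b : ℝ}
    (h : ∀ s ≤ L, ∫ ω in A ∩ τ ⁻¹' {s}, F s ω ∂P ≤ b * P.real (A ∩ τ ⁻¹' {s})) :
    ∫ ω in A, F (τ ω) ω ∂P ≤ b * P.real A := by
  have hU : A = ⋃ s ∈ Finset.range (L + 1), A ∩ τ ⁻¹' {s} := by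
    ext ω
    simp only [Finset.mem_range, Set.mem_iUnion, Set.mem_inter_iff, Set.mem_preimage,
      Set.mem_singleton_iff, exists_prop]
    exact ⟨fun hω => ⟨τ ω, Nat.lt_succ_of_le (hL ω), hω, rfl⟩, fun ⟨_, _, hω, _⟩ => hω⟩
  have hm : ∀ s ∈ Finset.range (L + 1), MeasurableSet (A ∩ τ ⁻¹' {s}) := fun s _ =>
    hA.inter (hτ (measurableSet_singleton s))
  have hd : Set.PairwiseDisjoint (↑(Finset.range (L + 1))) fun s => A ∩ τ ⁻¹' {s} := by
    intro s _ t _ hst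
    refine Set.disjoint_left.2 fun ω h1 h2 => hst ?_
    exact (h1.2 : τ ω = s).symm.trans h2.2
  have hcongr : ∀ s, Set.EqOn (F s) (fun ω => F (τ ω) ω) (A ∩ τ ⁻¹' {s}) := fun s ω hω => by
    simp only [show τ ω = s from hω.2]
  have h1 : ∫ ω in A, F (τ ω) ω ∂P =
      ∑ s ∈ Finset.range (L + 1), ∫ ω in A ∩ τ ⁻¹' {s}, F (τ ω) ω ∂P := by
    conv_lhs => rw [hU]
    exact integral_biUnion_finset _ hm hd fun s hs =>
      (hF s (by simpa [Nat.lt_succ_iff] using hs)).integrableOn.congr_fun (hcongr s) (hm s hs)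
  have h2 : P.real A = ∑ s ∈ Finset.range (L + 1), P.real (A ∩ τ ⁻¹' {s}) := by
    conv_lhs => rw [hU]
    exact measureReal_biUnion_finset hd hm
  rw [h1, h2, Finset.mul_sum]
  refine Finset.sum_le_sum fun s hs => ?_
  rw [← setIntegral_congr_fun (hm s hs) (hcongr s)]
  exact h s (by simpa [Nat.lt_succ_iff] using hs)

/-- Integrating `f ≤ f²/(2α) + α/2` avoids normalising by `P(A)`, which may vanish. -/
theorem setIntegral_le_of_setIntegral_sq_le {Ω : Type*} [MeasurableSpace Ω] {P : Measure Ω}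
    [IsFiniteMeasure P] {f : Ω → ℝ} (hf : Integrable f P) (hf2 : Integrable (fun ω => f ω ^ 2) P)
    {A : Set Ω} {α : ℝ} (hα : 0 < α) (h : ∫ ω in A, f ω ^ 2 ∂P ≤ α ^ 2 * P.real A) :
    ∫ ω in A, f ω ∂P ≤ α * P.real A := by
  have h1 : ∫ ω in A, f ω ∂P ≤ ∫ ω in A, ((2 * α)⁻¹ * f ω ^ 2 + α / 2) ∂P := by
    refine setIntegral_mono hf.integrableOn
      ((hf2.const_mul _).add (integrable_const _)).integrableOn fun ω => ?_
    have e : (2 * α)⁻¹ * f ω ^ 2 + α / 2 - f ω = (2 * α)⁻¹ * (f ω - α) ^ 2 := by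
      field_simp
      ring
    have : 0 ≤ (2 * α)⁻¹ * (f ω - α) ^ 2 := by positivity
    change f ω ≤ _
    linarith
  rw [integral_add (hf2.const_mul _).integrableOn (integrable_const _).integrableOn,
    integral_const_mul, setIntegral_const, smul_eq_mul] at h1
  have h2 := mul_le_mul_of_nonneg_left h (by positivity : 0 ≤ (2 * α)⁻¹)
  have e : (2 * α)⁻¹ * (α ^ 2 * P.real A) = α / 2 * P.real A := by
    field_simp
  linarith

namespace Run

variable {N : ℕ} {n : Fin N → ℕ} {d : ℕ} {Ω : Type*} {R : Run n d Ω}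

theorem updates_eq_of_forall_notMem {i : Fin N} {l k : ℕ} (hlk : l < k)
    (h : ∀ r, l < r → r < k → i ∉ R.I r) :
    R.updates i l = ((Finset.range k).filter fun r => i ∈ R.I r).card := by
  unfold updates
  congr 1
  ext r
  simp only [Finset.mem_filter, Finset.mem_range]
  constructor
  · rintro ⟨h1, h2⟩
    exact ⟨by omega, h2⟩
  · rintro ⟨h1, h2⟩
    refine ⟨?_, h2⟩
    by_contra h3
    exact h r (by omega) h1 h2

/-- Either player `i` has not yet been updated, or it was last updated at an epoch `l`. -/
theorem exists_last_update (R : Run n d Ω) (i : Fin N) (k : ℕ) :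
    (∀ r, r < k → i ∉ R.I r) ∨ ∃ l < k, i ∈ R.I l ∧ ∀ r, l < r → r < k → i ∉ R.I r := by
  induction k with
  | zero => exact Or.inl fun r hr => absurd hr (Nat.not_lt_zero r)
  | succ k ih =>
    by_cases hi : i ∈ R.I k
    · exact Or.inr ⟨k, Nat.lt_succ_self k, hi, fun r h1 h2 => by omega⟩
    · rcases ih with h | ⟨l, h1, h2, h3⟩
      · refine Or.inl fun r hr => ?_
        rcases Nat.lt_succ_iff_lt_or_eq.1 hr with h' | rfl
        exacts [h r h', hi]
      · refine Or.inr ⟨l, by omega, h2, fun r hr hr' => ?_⟩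
        rcases Nat.lt_succ_iff_lt_or_eq.1 hr' with h' | rfl
        exacts [h3 r hr h', hi]

variable [MeasurableSpace Ω] {P : Measure Ω} {G : Game n d Ω} {M : Fin N → ℝ} {B₁ B₂ : ℕ} {μ : ℝ}

/-- Each complete block of `B₁` epochs contributes at least one update. -/
theorem Protocol.div_le_card (hR : R.Protocol P B₁ B₂) (i : Fin N) (k : ℕ) :
    k / B₁ ≤ ((Finset.range k).filter fun r => i ∈ R.I r).card := by
  have key : ∀ m, m ≤ ((Finset.range (m * B₁)).filter fun r => i ∈ R.I r).card := by
    intro m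
    induction m with
    | zero => simp
    | succ m ih =>
      obtain ⟨l, h1, h2, h3⟩ := hR.update_often i (m * B₁)
      refine (Nat.add_le_add_right ih 1).trans ?_
      rw [← Finset.card_insert_of_notMem
        (a := l) (s := (Finset.range (m * B₁)).filter fun r => i ∈ R.I r)
        (by simp only [Finset.mem_filter, Finset.mem_range]; omega)]
      refine Finset.card_le_card (Finset.insert_subset ?_ ?_)
      · simp only [Finset.mem_filter, Finset.mem_range]
        exact ⟨by rw [Nat.add_mul]; omega, h3⟩
      · refine Finset.filter_subset_filter _ (Finset.range_subset_range.2 ?_)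
        exact Nat.mul_le_mul_right _ (Nat.le_succ m)
  refine (key _).trans (Finset.card_le_card (Finset.filter_subset_filter _ ?_))
  exact Finset.range_subset_range.2 (Nat.div_mul_le_self k B₁)

theorem IsExecution.x_eq_of_forall_notMem (hexec : R.IsExecution G P μ) {i : Fin N} {l k : ℕ}
    (hlk : l ≤ k) (h : ∀ r, l ≤ r → r < k → i ∉ R.I r) (ω : Ω) : R.x k ω i = R.x l ω i := by
  induction k, hlk using Nat.le_induction with
  | base => rfl
  | succ k hk ih =>
    rw [hexec.no_update k i (h k hk (Nat.lt_succ_self k))]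
    exact ih fun r h1 h2 => h r h1 (by omega)

variable [IsProbabilityMeasure P]

theorem IsExecution.integrable_norm_x_sub (hexec : R.IsExecution G P μ) (hG : G.Assumptions P M)
    (hR : R.Protocol P B₁ B₂) {xs : Profile n} (hxs : xs ∈ G.feasible) (k : ℕ) (i : Fin N) :
    Integrable (fun ω => ‖R.x k ω i - xs i‖) P := by
  have hx : Measurable fun ω => R.x k ω i :=
    measurable_profile_iff.1 ((hexec.measurable_x hG k).mono (hexec.info_le hR k) le_rfl) i
  refine Integrable.of_bound ((hx.sub_const _).norm).aestronglyMeasurable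
    (Metric.diam (G.X i)) (Filter.Eventually.of_forall fun ω => ?_)
  rw [norm_norm]
  exact hG.norm_sub_le_diam (hexec.x_mem k ω i) (hxs i)

/-- By independence, conditioning the initial error on the delays gives the constant `𝔼‖x_{i,0} -
x_i*‖`, which is at most `C` since a variance is nonnegative. -/
theorem IsExecution.setIntegral_init_le (hexec : R.IsExecution G P μ) (horacle : R.Oracle G P)
    (hG : G.Assumptions P M) (hR : R.Protocol P B₁ B₂) {xs : Profile n} (hxs : xs ∈ G.feasible)
    {C : ℝ} (hC : 0 ≤ C) {i : Fin N} (hinit : ∫ ω, ‖R.x 0 ω i - xs i‖ ^ 2 ∂P ≤ C ^ 2)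
    {A : Set Ω} (hA : MeasurableSet[R.delayInfo Set.univ] A) :
    ∫ ω in A, ‖R.x 0 ω i - xs i‖ ∂P ≤ C * P.real A := by
  have hint := hexec.integrable_norm_x_sub hG hR hxs 0 i
  have hm : Measurable[MeasurableSpace.comap (R.x 0) inferInstance]
      fun ω => ‖R.x 0 ω i - xs i‖ :=
    measurable_norm_sub (comap_measurable (R.x 0)) i (xs i)
  have hce := condExp_indep_eq hexec.measurable_init.comap_le (hR.delayInfo_le Set.univ)
    hm.stronglyMeasurable horacle.init_indep
  rw [← setIntegral_condExp (hR.delayInfo_le Set.univ) hint hA, integral_congr_ae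
    (ae_restrict_of_ae hce), setIntegral_const, smul_eq_mul, mul_comm]
  refine mul_le_mul_of_nonneg_right (abs_le_of_sq_le_sq' ?_ hC).2 measureReal_nonneg
  have hL2 : MemLp (fun ω => ‖R.x 0 ω i - xs i‖) 2 P := by
    refine MemLp.of_bound hint.aestronglyMeasurable (Metric.diam (G.X i))
      (Filter.Eventually.of_forall fun ω => ?_)
    rw [norm_norm]
    exact hG.norm_sub_le_diam (hexec.x_mem 0 ω i) (hxs i)
  have hv := variance_eq_sub hL2
  have hv0 := variance_nonneg (fun ω => ‖R.x 0 ω i - xs i‖) P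
  simp only [Pi.pow_apply] at hv
  linarith

/-- One inexact best-response update, in terms of a bound on the delayed profile. -/
theorem IsExecution.setIntegral_update_le (hexec : R.IsExecution G P μ) (horacle : R.Oracle G P)
    (hG : G.Assumptions P M) (hdd : G.DiagDominant P) (hμ : 0 < μ) (hR : R.Protocol P B₁ B₂)
    {xs : Profile n} (hxs : G.IsNash P xs) {α b : ℝ} (hα : 0 < α) (hb : 0 ≤ b) {l : ℕ}
    {i : Fin N} (hi : i ∈ R.I l) (hsteps : G.Q M μ i / α ^ 2 ≤ (R.steps i l : ℝ) + 1)
    (hdelay : ∀ s ≤ l, s ≤ B₂ → ∀ j, ∀ A, MeasurableSet[R.delayInfo Set.univ] A →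
      ∫ ω in A, ‖R.x (l - s) ω j - xs j‖ ∂P ≤ b * P.real A)
    {A : Set Ω} (hA : MeasurableSet[R.delayInfo Set.univ] A) :
    ∫ ω in A, ‖R.x (l + 1) ω i - xs i‖ ∂P ≤ (α + G.aInf P μ * b) * P.real A := by
  have hT := hR.delayInfo_le Set.univ
  set e : Ω → ℝ := fun ω => ‖R.x (l + 1) ω i - G.proxBR P μ i (R.y i l ω)‖ with he
  have he2 : Integrable (fun ω => e ω ^ 2) P := hexec.integrable_error_sq hG hdd hμ hR hi
  have hem : Measurable e :=
    ((measurable_profile_iff.1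
      ((hexec.measurable_x hG (l + 1)).mono (hexec.info_le hR (l + 1)) le_rfl) i).sub
      ((hexec.measurable_proxBR_y hG hdd hμ hi).mono (hexec.info_le hR l) le_rfl)).norm
  have heint : Integrable e P :=
    ((memLp_two_iff_integrable_sq hem.aestronglyMeasurable).2 he2).integrable one_le_two
  have herr : ∫ ω in A, e ω ∂P ≤ α * P.real A :=
    setIntegral_le_of_setIntegral_sq_le heint he2 hα
      (hexec.setIntegral_error_sq_le horacle hG hdd hμ hR hα hi hsteps
        ((le_sup_right : R.delayInfo Set.univ ≤ R.info l ⊔ R.delayInfo Set.univ) A hA))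
  have hy : ∀ j, ∫ ω in A, ‖R.y i l ω j - xs j‖ ∂P ≤ b * P.real A := by
    intro j
    refine setIntegral_random_index_le (hR.measurable_τ i j l)
      (F := fun s ω => ‖R.x (l - s) ω j - xs j‖) (fun ω => hR.delay_le_time l i hi j ω)
      (fun s _ => hexec.integrable_norm_x_sub hG hR hxs.1 _ j) (hT A hA) fun s hs => ?_
    by_cases hsB : s ≤ B₂
    -- The event `{τ = s}` belongs to the delay `σ`-field, which is why `hdelay` ranges over all its
    -- events.
    · exact hdelay s hs hsB j _ (hA.inter
        ((measurable_delay (S := Set.univ) trivial hi j) (measurableSet_singleton s)))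
    -- Delays beyond `B₂` occur only on a null event.
    · have h0 : P (A ∩ R.τ i j l ⁻¹' {s}) = 0 := by
        refine measure_mono_null (fun ω hω => ?_) (ae_iff.1 (hR.delay_le l i hi j))
        have : R.τ i j l ω = s := hω.2
        simpa [this] using hsB
      rw [Measure.restrict_eq_zero.2 h0, integral_zero_measure]
      positivity
  have hyint : ∀ j, Integrable (fun ω => ‖R.y i l ω j - xs j‖) P := by
    intro j
    have hym := measurable_profile_iff.1
      ((hexec.measurable_y hG hi).mono (hexec.info_le hR l) le_rfl) j
    refine Integrable.of_bound (hym.sub_const _).norm.aestronglyMeasurable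
      (Metric.diam (G.X j)) (Filter.Eventually.of_forall fun ω => ?_)
    rw [norm_norm]
    exact hG.norm_sub_le_diam (hexec.y_mem i l ω j) (hxs.1 j)
  have hsumint : Integrable
      (fun ω => ∑ j, G.gammaMatrix P μ i j * ‖R.y i l ω j - xs j‖) P :=
    integrable_finsetSum _ fun j _ => (hyint j).const_mul _
  calc ∫ ω in A, ‖R.x (l + 1) ω i - xs i‖ ∂P
      ≤ ∫ ω in A, (e ω + ∑ j, G.gammaMatrix P μ i j * ‖R.y i l ω j - xs j‖) ∂P := by
        refine setIntegral_mono (hexec.integrable_norm_x_sub hG hR hxs.1 _ i).integrableOn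
          (heint.add hsumint).integrableOn fun ω => ?_
        have h1 := hG.norm_proxBR_sub_le hdd hμ i (hexec.y_mem i l ω) hxs.1
        rw [hG.proxBR_nash hdd hμ i hxs] at h1
        exact (norm_sub_le_norm_sub_add_norm_sub _ _ _).trans (add_le_add_right h1 _)
    _ = ∫ ω in A, e ω ∂P +
          ∑ j, G.gammaMatrix P μ i j * ∫ ω in A, ‖R.y i l ω j - xs j‖ ∂P := by
        rw [integral_add heint.integrableOn hsumint.integrableOn,
          integral_finsetSum _ fun j _ => ((hyint j).const_mul _).integrableOn]
        simp_rw [integral_const_mul]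
    _ ≤ α * P.real A + ∑ j, G.gammaMatrix P μ i j * (b * P.real A) :=
        add_le_add herr (Finset.sum_le_sum fun j _ =>
          mul_le_mul_of_nonneg_left (hy j) (Game.gammaMatrix_nonneg hdd hμ i j))
    _ ≤ (α + G.aInf P μ * b) * P.real A := by
        rw [← Finset.sum_mul]
        have h1 := mul_le_mul_of_nonneg_right (Game.sum_gammaMatrix_le hdd hμ i)
          (by positivity : 0 ≤ b * P.real A)
        linarith

/-- Convergence of the asynchronous scheme, on every event determined by the delays. -/
theorem IsExecution.setIntegral_norm_x_sub_le (hexec : R.IsExecution G P μ)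
    (horacle : R.Oracle G P) (hG : G.Assumptions P M) (hdd : G.DiagDominant P) (hμ : 0 < μ)
    (hR : R.Protocol P B₁ B₂) {xs : Profile n} (hxs : G.IsNash P xs) {η : ℝ} (hη : 0 < η)
    {C : ℝ} (hC : 0 ≤ C) (hinit : ∀ i, ∫ ω, ‖R.x 0 ω i - xs i‖ ^ 2 ∂P ≤ C ^ 2)
    (hsteps : ∀ k, ∀ i ∈ R.I k,
      G.Q M μ i / (η ^ R.updates i k) ^ 2 ≤ (R.steps i k : ℝ) + 1)
    {ρ : ℝ} {n₀ : ℕ} (hρ0 : 0 < ρ) (hρ1 : ρ ≤ 1) (haρ : G.aInf P μ ≤ ρ ^ (n₀ + 1))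
    (hηρ : η ≤ ρ) (hB : B₂ ≤ B₁ * n₀) (k : ℕ) (i : Fin N) {A : Set Ω}
    (hA : MeasurableSet[R.delayInfo Set.univ] A) :
    ∫ ω in A, ‖R.x k ω i - xs i‖ ∂P ≤ (C + k) * ρ ^ (k / B₁) * P.real A := by
  induction k using Nat.strong_induction_on generalizing i A with
  | _ k ih =>
    rcases R.exists_last_update i k with h | ⟨l, hlk, hi, h⟩
    · have hk : k < B₁ := by
        obtain ⟨r, -, h2, h3⟩ := hR.update_often i 0
        by_contra hk
        exact h r (by omega) h3
      simp_rw [hexec.x_eq_of_forall_notMem (Nat.zero_le k) (fun r _ h2 => h r h2)]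
      rw [Nat.div_eq_of_lt hk, pow_zero, mul_one]
      refine (hexec.setIntegral_init_le horacle hG hR hxs.1 hC (hinit i) hA).trans ?_
      refine mul_le_mul_of_nonneg_right ?_ measureReal_nonneg
      simp
    · have hkl : k ≤ l + B₁ := by
        obtain ⟨r, h1, h2, h3⟩ := hR.update_often i (l + 1)
        by_contra hk
        exact h r (by omega) (by omega) h3
      set m := k / B₁ with hm
      -- Since `l` is the last update before `k`, the count at `l` already includes all updates
      -- before `k`, at least `⌊k/B₁⌋` of them.
      have hα : η ^ R.updates i l ≤ ρ ^ m := by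
        rw [updates_eq_of_forall_notMem hlk h]
        exact (pow_le_pow_left₀ hη.le hηρ _).trans
          (pow_le_pow_of_le_one hρ0.le hρ1 (hR.div_le_card i k))
      have hk1 : ((k - 1 : ℕ) : ℝ) + 1 = k := by
        rw [← Nat.cast_add_one]
        congr 1
        omega
      have hb : 0 ≤ (C + (k - 1 : ℕ)) * ρ ^ (m - (n₀ + 1)) := by positivity
      simp_rw [hexec.x_eq_of_forall_notMem (l := l + 1) hlk h]
      refine (hexec.setIntegral_update_le horacle hG hdd hμ hR hxs (pow_pos hη _) hb hi
        (hsteps l i hi) (fun s hs hsB j A hA => (ih (l - s) (by omega) j hA).trans ?_) hA).trans ?_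
      · refine mul_le_mul_of_nonneg_right (mul_le_mul ?_ ?_ (by positivity) (by positivity))
          measureReal_nonneg
        · have : ((l - s : ℕ) : ℝ) ≤ ((k - 1 : ℕ) : ℝ) := by
            exact_mod_cast (by omega : l - s ≤ k - 1)
          linarith
        · refine pow_le_pow_of_le_one hρ0.le hρ1 ?_
          -- The profile seen has index `l - s ≥ k - B₁ - B₁ n₀`, so at most `n₀ + 1` powers of `ρ`
          -- are lost; truncated subtraction covers small `k`.
          rw [hm, ← Nat.sub_mul_div]
          refine Nat.div_le_div_right ?_
          rw [Nat.mul_add, Nat.mul_one]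
          omega
      · refine mul_le_mul_of_nonneg_right ?_ measureReal_nonneg
        -- The contraction factor restores the lost powers; the tolerance adds one more `ρ ^ m`,
        -- raising the prefactor from `C + (k - 1)` to `C + k`.
        have h1 : G.aInf P μ * ρ ^ (m - (n₀ + 1)) ≤ ρ ^ m := by
          refine (mul_le_mul_of_nonneg_right haρ (by positivity)).trans ?_
          rw [← pow_add]
          exact pow_le_pow_of_le_one hρ0.le hρ1 (by omega)
        have h2 := mul_le_mul_of_nonneg_left h1
          (by positivity : (0 : ℝ) ≤ C + (k - 1 : ℕ))
        rw [← hk1]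
        linarith

end Run

/-! ### Convergence rate and step count -/

theorem sum_range_pow_succ_le {r : ℝ} (hr : 1 < r) (K : ℕ) :
    ∑ k ∈ Finset.range K, r ^ (k + 1) ≤ r ^ (K + 1) / Real.log r := by
  have hr0 : 0 < r := zero_lt_one.trans hr
  rw [le_div_iff₀ (Real.log_pos hr)]
  have h1 : ∑ k ∈ Finset.range K, r ^ (k + 1) = r * ∑ k ∈ Finset.range K, r ^ k := by
    rw [Finset.mul_sum]
    exact Finset.sum_congr rfl fun k _ => pow_succ' r k
  have h2 := geom_sum_mul r K
  have h3 : 0 ≤ ∑ k ∈ Finset.range K, r ^ (k + 1) := by positivity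
  have h4 := mul_le_mul_of_nonneg_left (Real.log_le_sub_one_of_pos hr0) h3
  refine h4.trans ?_
  rw [h1, mul_assoc, h2, pow_succ']
  nlinarith

theorem rpow_log_div_log {r e q : ℝ} (hr : 0 < r) (he : 0 < e) :
    (1 / e) ^ (Real.log r / Real.log (1 / q)) = r ^ (Real.log (1 / e) / Real.log (1 / q)) := by
  rw [Real.rpow_def_of_pos (by positivity), Real.rpow_def_of_pos hr]
  congr 1
  ring

/-- Each rounding up costs at most one step, which produces the summand `⌈T⌉`; the bound `r^(⌈T⌉+1)
≤ r² r^T` with `r = η⁻²` produces `η⁴` in the denominator. -/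
theorem sum_ceil_le_ell {Q η q e : ℝ} (hQ : 0 ≤ Q) (hη0 : 0 < η) (hη1 : η < 1) (he : 0 < e) :
    ((∑ k ∈ Finset.range ⌈Real.log (1 / e) / Real.log (1 / q)⌉₊,
      ⌈Q / η ^ (2 * (k + 1))⌉₊ : ℕ) : ℝ) ≤ ell Q η q e := by
  set T := Real.log (1 / e) / Real.log (1 / q) with hT
  set r := 1 / η ^ 2 with hr
  have hr1 : 1 < r := by
    rw [hr, lt_div_iff₀ (by positivity), one_mul]
    exact pow_lt_one₀ hη0.le hη1 (by norm_num)
  have hr0 : 0 < r := zero_lt_one.trans hr1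
  have hlog := Real.log_pos hr1
  have h1 : ((∑ k ∈ Finset.range ⌈T⌉₊, ⌈Q / η ^ (2 * (k + 1))⌉₊ : ℕ) : ℝ) ≤
      Q * ∑ k ∈ Finset.range ⌈T⌉₊, r ^ (k + 1) + ⌈T⌉₊ := by
    push_cast
    calc ∑ k ∈ Finset.range ⌈T⌉₊, (⌈Q / η ^ (2 * (k + 1))⌉₊ : ℝ)
        ≤ ∑ k ∈ Finset.range ⌈T⌉₊, (Q * r ^ (k + 1) + 1) := by
          refine Finset.sum_le_sum fun k _ => ?_
          refine (Nat.ceil_lt_add_one (by positivity)).le.trans (le_of_eq ?_)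
          rw [hr, one_div, inv_pow, ← pow_mul, div_eq_mul_inv]
      _ = _ := by
          rw [Finset.sum_add_distrib, Finset.mul_sum]
          simp
  refine h1.trans ?_
  unfold ell
  rw [← hr, rpow_log_div_log hr0 he, ← hT]
  refine add_le_add_left ?_ _
  rcases le_or_gt T 0 with hT0 | hT0
  · rw [Nat.ceil_eq_zero.2 hT0]
    simp only [Finset.range_zero, Finset.sum_empty, mul_zero]
    positivity
  · have h2 : r ^ (⌈T⌉₊ + 1) ≤ r ^ 2 * r ^ T := by
      rw [← Real.rpow_natCast, ← Real.rpow_natCast, ← Real.rpow_add hr0]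
      refine Real.rpow_le_rpow_of_exponent_le hr1.le ?_
      have := Nat.ceil_lt_add_one hT0.le
      push_cast
      linarith
    calc Q * ∑ k ∈ Finset.range ⌈T⌉₊, r ^ (k + 1)
        ≤ Q * (r ^ (⌈T⌉₊ + 1) / Real.log r) :=
          mul_le_mul_of_nonneg_left (sum_range_pow_succ_le hr1 _) hQ
      _ ≤ Q * (r ^ 2 * r ^ T / Real.log r) := by gcongr
      _ = Q / (η ^ 4 * Real.log r) * r ^ T := by
          have : r ^ 2 = 1 / η ^ 4 := by rw [hr]; field_simp
          rw [this]
          field_simp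

/-- With `L = ln(q/c)`, the inequality `kL ≤ exp(kL - 1)` gives `k (c/q)^k ≤ 1/(e L)`, the least
value allowed for `D`. -/
theorem natCast_mul_pow_le {c q D : ℝ} (hc : 0 < c) (hcq : c < q)
    (hD : 1 / Real.log ((q / c) ^ Real.exp 1) ≤ D) (k : ℕ) : k * c ^ k ≤ D * q ^ k := by
  have hq : 0 < q := hc.trans hcq
  have hqc : 1 < q / c := (one_lt_div hc).2 hcq
  have hL := Real.log_pos hqc
  rw [Real.log_rpow (by positivity)] at hD
  set L := Real.log (q / c) with hLdef
  have h1 : q ^ k = c ^ k * Real.exp (k * L) := by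
    rw [mul_comm (k : ℝ) L, Real.exp_mul, hLdef, Real.exp_log (by positivity), Real.rpow_natCast,
      div_pow]
    field_simp
  have h2 : (k : ℝ) ≤ 1 / (Real.exp 1 * L) * Real.exp (k * L) := by
    have h3 := Real.add_one_le_exp (k * L - 1)
    rw [Real.exp_sub, sub_add_cancel, le_div_iff₀ (Real.exp_pos 1)] at h3
    rw [div_mul_eq_mul_div, one_mul, le_div_iff₀ (by positivity)]
    linarith
  calc (k : ℝ) * c ^ k ≤ D * Real.exp (k * L) * c ^ k := by
        gcongr
        exact h2.trans (by gcongr)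
    _ = D * q ^ k := by rw [h1]; ring

theorem pow_le_of_ceil_le {q e : ℝ} (hq0 : 0 < q) (hq1 : q < 1) (he : 0 < e) {k : ℕ}
    (hk : ⌈Real.log (1 / e) / Real.log (1 / q)⌉₊ ≤ k) : q ^ k ≤ e := by
  have hlog : 0 < Real.log (1 / q) := Real.log_pos ((one_lt_div hq0).2 hq1)
  have h := Nat.ceil_le.1 hk
  rw [div_le_iff₀ hlog, one_div, one_div, Real.log_inv, Real.log_inv] at h
  rw [← Real.log_le_log_iff (by positivity) he, Real.log_pow]
  linarith

section Rate

variable {a η : ℝ} {B₁ B₂ : ℕ}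

theorem rho_pos (hη : 0 < η) : 0 < rho a η B₁ B₂ :=
  Real.rpow_pos_of_pos (lt_max_of_lt_right hη) _

theorem rho_pow (hη : 0 < η) : rho a η B₁ B₂ ^ (⌈(B₂ : ℝ) / (B₁ : ℝ)⌉₊ + 1) = max a η := by
  have h0 : 0 < max a η := lt_max_of_lt_right hη
  rw [← Real.rpow_natCast, rho, ← Real.rpow_mul h0.le]
  push_cast
  rw [one_div_mul_cancel (by positivity), Real.rpow_one]

theorem rho_le_one (hη : 0 < η) (ha1 : a < 1) (hη1 : η < 1) : rho a η B₁ B₂ ≤ 1 :=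
  Real.rpow_le_one (lt_max_of_lt_right hη).le (max_lt ha1 hη1).le (by positivity)

theorem le_rho (hη : 0 < η) (ha1 : a < 1) (hη1 : η < 1) : η ≤ rho a η B₁ B₂ := by
  refine (le_max_right a η).trans ?_
  rw [← rho_pow (B₁ := B₁) (B₂ := B₂) hη]
  exact pow_le_of_le_one (rho_pos hη).le (rho_le_one hη ha1 hη1) (Nat.succ_ne_zero _)

/-- From `⌊k/B₁⌋ ≥ (k + 1)/B₁ - 1 = k/B₁ - (B₁ - 1)/B₁`; this rounding loss is the reason for the
power of `ρ` in `epsHat`. -/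
theorem rho_pow_div_le (hB : 0 < B₁) (hη : 0 < η) (ha1 : a < 1) (hη1 : η < 1) (k : ℕ) :
    rho a η B₁ B₂ ^ (k / B₁) ≤
      cRate a η B₁ B₂ ^ k / rho a η B₁ B₂ ^ (((B₁ : ℝ) - 1) / (B₁ : ℝ)) := by
  have h0 : 0 < rho a η B₁ B₂ := rho_pos hη
  have hB' : (0 : ℝ) < B₁ := by exact_mod_cast hB
  rw [cRate, ← Real.rpow_natCast, ← Real.rpow_natCast, ← Real.rpow_mul h0.le,
    ← Real.rpow_sub h0]
  refine Real.rpow_le_rpow_of_exponent_ge h0 (rho_le_one hη ha1 hη1) ?_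
  have h1 : k + 1 ≤ B₁ * (k / B₁) + B₁ := by
    have := Nat.div_add_mod k B₁
    have := Nat.mod_lt k hB
    omega
  have h2 : (k : ℝ) + 1 ≤ B₁ * ((k / B₁ : ℕ) : ℝ) + B₁ := by exact_mod_cast h1
  rw [one_div_mul_eq_div, ← sub_div, div_le_iff₀ hB']
  linarith

theorem add_mul_rho_pow_div_le {C D q ε : ℝ} (hB : 0 < B₁) (hη : 0 < η) (ha1 : a < 1)
    (hη1 : η < 1) (hC : 0 ≤ C) (hCD : 0 < C + D) (hqc : cRate a η B₁ B₂ < q)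
    (hD : 1 / Real.log ((q / cRate a η B₁ B₂) ^ Real.exp 1) ≤ D) {k : ℕ}
    (hk : q ^ k ≤ epsHat a η C D ε B₁ B₂) : (C + k) * rho a η B₁ B₂ ^ (k / B₁) ≤ ε := by
  have hρ : 0 < rho a η B₁ B₂ := rho_pos hη
  have hc : 0 < cRate a η B₁ B₂ := Real.rpow_pos_of_pos hρ _
  have hs : 0 < rho a η B₁ B₂ ^ (((B₁ : ℝ) - 1) / (B₁ : ℝ)) := Real.rpow_pos_of_pos hρ _
  have h1 := rho_pow_div_le (B₂ := B₂) hB hη ha1 hη1 k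
  have h2 : (C + k) * cRate a η B₁ B₂ ^ k ≤ (C + D) * q ^ k := by
    have h3 := natCast_mul_pow_le hc hqc hD k
    have h4 : C * cRate a η B₁ B₂ ^ k ≤ C * q ^ k := by gcongr
    linarith
  calc (C + k) * rho a η B₁ B₂ ^ (k / B₁)
      ≤ (C + k) * (cRate a η B₁ B₂ ^ k / rho a η B₁ B₂ ^ (((B₁ : ℝ) - 1) / (B₁ : ℝ))) := by
        gcongr
    _ = (C + k) * cRate a η B₁ B₂ ^ k / rho a η B₁ B₂ ^ (((B₁ : ℝ) - 1) / (B₁ : ℝ)) := by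
        rw [mul_div_assoc]
    _ ≤ ε := by
        rw [div_le_iff₀ hs]
        refine h2.trans ((mul_le_mul_of_nonneg_left hk hCD.le).trans (le_of_eq ?_))
        rw [epsHat]
        field_simp

theorem one_div_log_rpow_exp_pos {c q : ℝ} (hc : 0 < c) (hqc : c < q) :
    0 < 1 / Real.log ((q / c) ^ Real.exp 1) := by
  have hqc' : 1 < q / c := (one_lt_div hc).2 hqc
  exact one_div_pos.2 (Real.log_pos (Real.one_lt_rpow hqc' (Real.exp_pos 1)))

theorem rho_one_zero : rho a η 1 0 = max a η := by simp [rho]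

theorem cRate_one_zero : cRate a η 1 0 = max a η := by simp [cRate, rho_one_zero]

theorem ell_epsHat_one_zero {Q C D q ε : ℝ} : ell Q η q (epsHat a η C D ε 1 0) =
    Q / (η ^ 4 * Real.log (1 / η ^ 2)) *
        ((C + D) / ε) ^ (Real.log (1 / η ^ 2) / Real.log (1 / q))
      + (⌈Real.log ((C + D) / ε) / Real.log (1 / q)⌉₊ : ℝ) := by
  have h : (1 : ℝ) / epsHat a η C D ε 1 0 = (C + D) / ε := by simp [epsHat]
  rw [ell, h]

end Rate

end AsyncBR

/-! ### The main theorem -/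

open AsyncBR in
theorem mainTheorem10 {N d : ℕ} {n : Fin N → ℕ} {Ω : Type*} [MeasurableSpace Ω]
    (P : Measure Ω) [IsProbabilityMeasure P]
    (G : Game n d Ω) (M : Fin N → ℝ) (hG : G.Assumptions P M) (hdd : G.DiagDominant P)
    (μ : ℝ) (hμ : 0 < μ)
    (xs : Profile n) (hxs : G.IsNash P xs)
    (R : Run n d Ω) (B₁ B₂ : ℕ) (hR : R.Protocol P B₁ B₂) (hexec : R.IsExecution G P μ)
    (horacle : R.Oracle G P)
    (η : ℝ) (hη0 : 0 < η) (hη1 : η < 1)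
    (C : ℝ) (hC : 0 ≤ C) (hinit : ∀ i, ∫ ω, ‖R.x 0 ω i - xs i‖ ^ 2 ∂P ≤ C ^ 2)
    -- the deterministic numbers of inner steps, tuned to the tolerances `η ^ β_{i,k}`
    (hsteps_lower : ∀ k, ∀ i ∈ R.I k,
      G.Q M μ i / (η ^ R.updates i k) ^ 2 ≤ (R.steps i k : ℝ) + 1)
    (hsteps_upper : ∀ k, ∀ i ∈ R.I k,
      R.steps i k ≤ ⌈G.Q M μ i / η ^ (2 * (k + 1))⌉₊)
    (q : ℝ) (hqc : cRate (G.aInf P μ) η B₁ B₂ < q) (hq1 : q < 1)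
    (D : ℝ) (hD : 1 / Real.log ((q / cRate (G.aInf P μ) η B₁ B₂) ^ Real.exp 1) ≤ D)
    (ε : ℝ) (hε : 0 < ε) :
    -- the inner loops meet the tolerances of the inexact scheme
    (∀ k, ∀ i ∈ R.I k,
      P[fun ω => ‖R.x (k + 1) ω i - G.proxBR P μ i (R.y i k ω)‖ ^ 2 | R.info k] ≤ᵐ[P]
        fun _ => (η ^ R.updates i k) ^ 2) ∧
    -- the iterates are `ε`-NE_∞ from some `x_K` on, computed within the stated number of steps
    (∃ K : ℕ, (∀ k, K ≤ k → IsEpsNEInf P xs ε (R.x k)) ∧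
      ∀ i, (R.totalSteps i K : ℝ) ≤
        ell (G.Q M μ i) η q (epsHat (G.aInf P μ) η C D ε B₁ B₂)) ∧
    -- the special case `B₁ = 1`, `B₂ = 0`
    (B₁ = 1 → B₂ = 0 →
      cRate (G.aInf P μ) η B₁ B₂ = max (G.aInf P μ) η ∧
      ∀ i, ell (G.Q M μ i) η q (epsHat (G.aInf P μ) η C D ε B₁ B₂) =
        G.Q M μ i / (η ^ 4 * Real.log (1 / η ^ 2)) *
            ((C + D) / ε) ^ (Real.log (1 / η ^ 2) / Real.log (1 / q))
          + (⌈Real.log ((C + D) / ε) / Real.log (1 / q)⌉₊ : ℝ)) := by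
  have hB := hR.B₁_pos
  have ha1 := Game.aInf_lt_one hdd hμ
  have hc : 0 < cRate (G.aInf P μ) η B₁ B₂ := Real.rpow_pos_of_pos (rho_pos hη0) _
  have hq0 : 0 < q := hc.trans hqc
  have hCD : 0 < C + D :=
    add_pos_of_nonneg_of_pos hC ((one_div_log_rpow_exp_pos hc hqc).trans_le hD)
  have he : 0 < epsHat (G.aInf P μ) η C D ε B₁ B₂ :=
    mul_pos (div_pos hε hCD) (Real.rpow_pos_of_pos (rho_pos hη0) _)
  have hdelay : B₂ ≤ B₁ * ⌈(B₂ : ℝ) / (B₁ : ℝ)⌉₊ := by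
    have hB' : (0 : ℝ) < B₁ := by exact_mod_cast hB
    have h := Nat.le_ceil ((B₂ : ℝ) / (B₁ : ℝ))
    rw [div_le_iff₀' hB'] at h
    exact_mod_cast h
  refine ⟨fun k i hi => hexec.condExp_error_sq_le horacle hG hdd hμ hR (pow_pos hη0 _) hi
    (hsteps_lower k i hi),
    -- This `K` ensures `q ^ k ≤ epsHat` for all `k ≥ K`.
    ⟨⌈Real.log (1 / epsHat (G.aInf P μ) η C D ε B₁ B₂) / Real.log (1 / q)⌉₊, fun k hk i =>
      ⟨hexec.integrable_norm_x_sub hG hR hxs.1 k i, ?_⟩,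
    fun i => le_trans ?_ (sum_ceil_le_ell (q := q) (hG.Q_pos hμ i).le hη0 hη1 he)⟩, ?_⟩
  · have h := hexec.setIntegral_norm_x_sub_le horacle hG hdd hμ hR hxs hη0 hC hinit hsteps_lower
      (rho_pos hη0) (rho_le_one hη0 ha1 hη1)
      ((le_max_left _ _).trans (rho_pow (B₁ := B₁) (B₂ := B₂) hη0).ge)
      (le_rho hη0 ha1 hη1) hdelay k i MeasurableSet.univ
    rw [setIntegral_univ, probReal_univ, mul_one] at h
    exact h.trans (add_mul_rho_pow_div_le hB hη0 ha1 hη1 hC hCD hqc hD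
      (pow_le_of_ceil_le hq0 hq1 he hk))
  -- The player is charged as if active in all `K` epochs.
  · refine Nat.cast_le.2 ((Finset.sum_le_sum fun k hk =>
      hsteps_upper k i (Finset.mem_filter.1 hk).2).trans ?_)
    exact Finset.sum_le_sum_of_subset (Finset.filter_subset _ _)
  · rintro rfl rfl
    exact ⟨cRate_one_zero, fun i => ell_epsHat_one_zero⟩
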